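/- Everything is smooth ($C^\infty$) and finite-dimensional. Let $(M,\omega)$ be a symplectic manifold of dimension $d=2s$, let $H:M\to\mathbb{R}$ be a smooth function with Hamiltonian vector field $X_H$ given by $\mathsf{i}_{X_H}\omega=\mathsf{d}H$, and let $\Pi:M\to N$ be a surjective submersion onto a manifold $N$ of dimension $k\ge 1$. For a subspace $W\subseteq T_pM$ let $W^{\bot}$ be its orthogonal with respect to $\omega_p$. Let $m\in M$ be a point such that $X_H(m)\notin\mathsf{Ker}\,\Pi_{*,m}$ and $(\mathsf{Ker}\,\Pi_{*,m})^{\bot}\subseteq\mathsf{Ker}\,\Pi_{*,m}$, and put $l=\dim\mathsf{Ker}\,\Pi_{*,m}=d-k$. (1) There are an open neighborhood $U$ of $m$ and a (smooth, constant rank) distribution $\mathcal{D}$ along $U$ such that (a) $X_H(p)\in\mathcal{D}_p$ for all $p\in U$; (b) $T_pM=\mathsf{Ker}\,\Pi_{*,p}\oplus\mathcal{D}_p$ for all $p\in U$; (c) $\mathcal{D}_p\subseteq\mathcal{D}_p^{\bot}$ for all $p\in U$; (d) $\mathcal{D}$ is integrable (around each point of $U$ there is a chart in which $\mathcal{D}$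 is a constant distribution), and there is a submersion $F:U\to\mathbb{R}^l$ with $\mathcal{D}_p=\mathsf{Ker}\,F_{*,p}$ for all $p\in U$. (2) Moreover, $U$, $\mathcal{D}$ and $F$ as in (1) can be chosen such that the distribution $\mathcal{D}^{\bot}$ is also integrable. In other words, $F:U\to\mathbb{R}^l$ is then a submersion with $X_H(p)\in\mathsf{Ker}\,F_{*,p}$ and $T_pM=\mathsf{Ker}\,\Pi_{*,p}\oplus\mathsf{Ker}\,F_{*,p}$ for all $p\in U$, which is isotropic ($\mathsf{Ker}\,F_*\subseteq(\mathsf{Ker}\,F_*)^{\bot}$) and symplectically complete ($(\mathsf{Ker}\,F_*)^{\bot}$ is integrable). -/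

import Mathlib

open scoped Manifold ContDiff Topology

/-- The standard Euclidean space of dimension `n`. -/
notation "𝔼[" n "]" => EuclideanSpace ℝ (Fin n)

noncomputable section

namespace HamiltonJacobi

section Forms

variable {E : Type*} [NormedAddCommGroup E] [NormedSpace ℝ E]
  {M : Type*} [TopologicalSpace M] [ChartedSpace E M]

/-- The expression of a 2-form `Ω` on `M` in a chart `e`, that is, the pullback of `Ω` along the
inverse of `e`. It is meaningful on `e.target`. -/
def formInChart (Ω : ∀ p : M, (TangentSpace 𝓘(ℝ, E) p) [⋀^Fin 2]→L[ℝ] ℝ)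
    (e : OpenPartialHomeomorph M E) : E → E [⋀^Fin 2]→L[ℝ] ℝ :=
  fun y => (Ω (e.symm y)).compContinuousLinearMap (mfderiv 𝓘(ℝ, E) 𝓘(ℝ, E) e.symm y)

variable (E M) in
/-- A symplectic form: a smooth, closed, nondegenerate 2-form. Smoothness and closedness are
expressed in the charts of the smooth structure of `M`. -/
structure SymplecticForm where
  /-- The value of the form at each point. -/
  toFun : ∀ p : M, (TangentSpace 𝓘(ℝ, E) p) [⋀^Fin 2]→L[ℝ] ℝ
  smooth : ∀ e ∈ IsManifold.maximalAtlas 𝓘(ℝ, E) ∞ M,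
    ContDiffOn ℝ ∞ (formInChart toFun e) e.target
  closed : ∀ e ∈ IsManifold.maximalAtlas 𝓘(ℝ, E) ∞ M,
    ∀ y ∈ e.target, extDeriv (formInChart toFun e) y = 0
  nondegenerate : ∀ (p : M) (v : TangentSpace 𝓘(ℝ, E) p),
    (∀ w : TangentSpace 𝓘(ℝ, E) p, toFun p ![v, w] = 0) → v = 0

/-- The contraction `v ↦ i_v Ω = Ω(v, ·)` at a point. -/
def SymplecticForm.flat (Ω : SymplecticForm E M) (p : M) :
    TangentSpace 𝓘(ℝ, E) p →ₗ[ℝ] Module.Dual ℝ (TangentSpace 𝓘(ℝ, E) p) :=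
  LinearMap.mk₂ ℝ (fun v w => Ω.toFun p ![v, w])
    (fun v v' w => (Ω.toFun p).toMultilinearMap.cons_add ![w] v v')
    (fun c v w => (Ω.toFun p).toMultilinearMap.cons_smul ![w] c v)
    (fun v w w' => by
      have h := (Ω.toFun p).toMultilinearMap.map_update_add ![v, w] 1 w w'
      have e : ∀ z, Function.update ![v, w] 1 z = ![v, z] := fun z => by
        ext i; fin_cases i <;> rfl
      rw [e, e, e] at h
      exact h)
    (fun c v w => by
      have h := (Ω.toFun p).toMultilinearMap.map_update_smul ![v, w] 1 c w
      have e : ∀ z, Function.update ![v, w] 1 z = ![v, z] := fun z => by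
        ext i; fin_cases i <;> rfl
      rw [e, e] at h
      exact h)

theorem SymplecticForm.flat_injective (Ω : SymplecticForm E M) (p : M) :
    Function.Injective (Ω.flat p) := by
  rw [injective_iff_map_eq_zero]
  intro v hv
  exact Ω.nondegenerate p v (fun w => LinearMap.congr_fun hv w)

/-- On a finite-dimensional symplectic manifold, every covector is `Ω(v, ·)` for some `v`. -/
theorem SymplecticForm.flat_surjective [FiniteDimensional ℝ E] (Ω : SymplecticForm E M) (p : M) :
    Function.Surjective (Ω.flat p) := by
  have : FiniteDimensional ℝ (TangentSpace 𝓘(ℝ, E) p) := inferInstanceAs (FiniteDimensional ℝ E)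
  exact (LinearMap.injective_iff_surjective_of_finrank_eq_finrank
    (Subspace.dual_finrank_eq (K := ℝ) (V := TangentSpace 𝓘(ℝ, E) p)).symm).1 (Ω.flat_injective p)

/-- The Hamiltonian vector field `X_H` of a function `H`: the vector field with
`i_{X_H} Ω = dH`. -/
def hamiltonianVectorField [FiniteDimensional ℝ E] (Ω : SymplecticForm E M) (H : M → ℝ) (p : M) :
    TangentSpace 𝓘(ℝ, E) p :=
  Classical.choose (Ω.flat_surjective p (mfderiv 𝓘(ℝ, E) 𝓘(ℝ, ℝ) H p).toLinearMap)

/-- The defining property of the Hamiltonian vector field; by nondegeneracy it determines it. -/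
theorem hamiltonianVectorField_spec [FiniteDimensional ℝ E] (Ω : SymplecticForm E M) (H : M → ℝ)
    (p : M) (w : TangentSpace 𝓘(ℝ, E) p) :
    Ω.toFun p ![hamiltonianVectorField Ω H p, w] = mfderiv 𝓘(ℝ, E) 𝓘(ℝ, ℝ) H p w :=
  LinearMap.congr_fun (Classical.choose_spec
    (Ω.flat_surjective p (mfderiv 𝓘(ℝ, E) 𝓘(ℝ, ℝ) H p).toLinearMap)) w

/-- The symplectic orthogonal `W^⊥` of a subspace `W` of a tangent space. -/
def symplecticOrthogonal (Ω : SymplecticForm E M) (p : M)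
    (W : Submodule ℝ (TangentSpace 𝓘(ℝ, E) p)) : Submodule ℝ (TangentSpace 𝓘(ℝ, E) p) where
  carrier := {v | ∀ w ∈ W, Ω.toFun p ![v, w] = 0}
  zero_mem' := fun w _ => LinearMap.congr_fun ((Ω.flat p).map_zero) w
  add_mem' := fun {a b} ha hb w hw => by
    have h := LinearMap.congr_fun ((Ω.flat p).map_add a b) w
    exact h.trans (by
      change Ω.toFun p ![a, w] + Ω.toFun p ![b, w] = 0
      rw [ha w hw, hb w hw, add_zero])
  smul_mem' := fun c a ha w hw => by
    have h := LinearMap.congr_fun ((Ω.flat p).map_smul c a) w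
    exact h.trans (by
      change c • Ω.toFun p ![a, w] = 0
      rw [ha w hw, smul_zero])

end Forms

section Distributions

variable {E : Type*} [NormedAddCommGroup E] [NormedSpace ℝ E]
  {M : Type*} [TopologicalSpace M] [ChartedSpace E M] [IsManifold 𝓘(ℝ, E) ∞ M]

/-- `D` is a (smooth) distribution of rank `r` along the open set `U`: near each point of `U` it is
spanned by `r` smooth, pointwise linearly independent vector fields. Values of `D` outside `U` are
irrelevant. -/
def IsDistribution (r : ℕ) (U : Set M) (D : ∀ p : M, Submodule ℝ (TangentSpace 𝓘(ℝ, E) p)) :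
    Prop :=
  ∀ p ∈ U, ∃ V : Set M, IsOpen V ∧ p ∈ V ∧ V ⊆ U ∧
    ∃ X : Fin r → ∀ q : M, TangentSpace 𝓘(ℝ, E) q,
      (∀ i, ContMDiffOn 𝓘(ℝ, E) 𝓘(ℝ, E).tangent ∞
        (fun q => (⟨q, X i q⟩ : TangentBundle 𝓘(ℝ, E) M)) V) ∧
      ∀ q ∈ V, LinearIndependent ℝ (fun i => X i q) ∧
        D q = Submodule.span ℝ (Set.range fun i => X i q)

/-- `D` is (completely) integrable along `U`: around each point of `U` there is a flat chart, that
is, a chart of the smooth structure in which `D` is the constant distribution with value a fixed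
subspace `W` of the model space (so that the leaves of `D` are the slices parallel to `W`). -/
def IsIntegrable (U : Set M) (D : ∀ p : M, Submodule ℝ (TangentSpace 𝓘(ℝ, E) p)) : Prop :=
  ∀ p ∈ U, ∃ e ∈ IsManifold.maximalAtlas 𝓘(ℝ, E) ∞ M, p ∈ e.source ∧ e.source ⊆ U ∧
    ∃ W : Submodule ℝ E, ∀ (q : M) (v : TangentSpace 𝓘(ℝ, E) q), q ∈ e.source →
      (v ∈ D q ↔ mfderiv 𝓘(ℝ, E) 𝓘(ℝ, E) e q v ∈ W)

end Distributions

section Submersions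

variable {E : Type*} [NormedAddCommGroup E] [NormedSpace ℝ E]
  {M : Type*} [TopologicalSpace M] [ChartedSpace E M]
  {E' : Type*} [NormedAddCommGroup E'] [NormedSpace ℝ E']
  {N : Type*} [TopologicalSpace N] [ChartedSpace E' N]

variable (E E')

/-- The kernel `Ker f_{*,p}` of the differential of `f` at `p`. -/
def kerDiff (f : M → N) (p : M) : Submodule ℝ (TangentSpace 𝓘(ℝ, E) p) :=
  (mfderiv 𝓘(ℝ, E) 𝓘(ℝ, E') f p).ker

/-- `f` restricts to a smooth submersion on the open set `U`: it is smooth there and its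
differential at each point of `U` is surjective. -/
structure IsSubmersionOn (U : Set M) (f : M → N) : Prop where
  smooth : ContMDiffOn 𝓘(ℝ, E) 𝓘(ℝ, E') ∞ f U
  surjective_mfderiv : ∀ p ∈ U, Function.Surjective (mfderiv 𝓘(ℝ, E) 𝓘(ℝ, E') f p)

/-- A fibration: a surjective (smooth) submersion. -/
structure IsFibration (f : M → N) : Prop where
  surjective : Function.Surjective f
  submersion : IsSubmersionOn E E' Set.univ f

/-- `F` is a first integrals submersion on `U`: a submersion whose fibres are tangent to `X_H`. -/
def IsFirstIntegralsSubmersion [FiniteDimensional ℝ E] (Ω : SymplecticForm E M) (H : M → ℝ)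
    (U : Set M) (F : M → N) : Prop :=
  IsSubmersionOn E E' U F ∧
    ∀ p ∈ U, hamiltonianVectorField Ω H p ∈ kerDiff E E' F p

/-- `F` is isotropic on `U`: `Ker F_* ⊆ (Ker F_*)^⊥` there. -/
def IsIsotropicMap (Ω : SymplecticForm E M) (U : Set M) (F : M → N) : Prop :=
  ∀ p ∈ U, kerDiff E E' F p ≤
    symplecticOrthogonal Ω p (kerDiff E E' F p)

/-- An isotropic submersion `F` is symplectically complete on `U` if `(Ker F_*)^⊥` is an integrable
distribution there. -/
def IsSymplecticallyComplete [IsManifold 𝓘(ℝ, E) ∞ M] (Ω : SymplecticForm E M) (U : Set M)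
    (F : M → N) : Prop :=
  IsSubmersionOn E E' U F ∧ IsIsotropicMap E E' Ω U F ∧
    IsIntegrable U (fun p => symplecticOrthogonal Ω p (kerDiff E E' F p))

end Submersions

end HamiltonJacobi

end

open HamiltonJacobi

/-! The theorem becomes linear algebra in a chart where both Ω and X_H are constant. There,
`exists_isotropic_isCompl` gives an isotropic complement W of the coisotropic subspace Ker Π_* at m,
through the constant vector X_H: an isotropic subspace that contains this vector, meets the kernel
trivially and is maximal with these properties is already a complement. Let D be the distribution
with constant value W. It is isotropic and contains X_H; D and D^⊥ are both constant in the chart,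
hence integrable; and D is the kernel of F_* for F = A ∘ chart, where A is linear with kernel W.
Complementarity to Ker Π_*, arranged only at m, persists nearby (`eventually_isCompl_kerDiff`).

The chart is a Darboux chart adapted to H; it exists because X_H(m) lies outside a subspace and so
is nonzero. Starting from f_0 = H, `IsSymplecticNear.exists_constant_brackets` builds, one at a
time, dim M functions with constant Poisson brackets and independent Hamiltonian fields. Constant
brackets make these fields commute, and the next function is found by prescribing its derivatives
along them (`exists_smooth_of_commuting_fields`): a solution is transported along the flow of one
field from a transverse hypersurface. With the f_i as coordinates, up to a linear change, the
Hamiltonian fields are constant, and therefore so is Ω.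

Smoothness of flows comes from the implicit function theorem in a Banach space of curves
(`exists_smooth_flow`). -/

namespace HamiltonJacobi

/-! ### Smoothness of superposition operators on spaces of continuous curves. -/

section Nemytskii

universe u

variable {K : Type*} [TopologicalSpace K] [CompactSpace K]

/-- A continuous bilinear map, applied pointwise to continuous functions. -/
noncomputable def pointwiseBilin (K : Type*) [TopologicalSpace K] [CompactSpace K]
    {E F G : Type*} [NormedAddCommGroup E] [NormedSpace ℝ E] [NormedAddCommGroup F]
    [NormedSpace ℝ F] [NormedAddCommGroup G] [NormedSpace ℝ G] (B : G →L[ℝ] E →L[ℝ] F) :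
    C(K, G) →L[ℝ] C(K, E) →L[ℝ] C(K, F) :=
  LinearMap.mkContinuous₂
    (LinearMap.mk₂ ℝ (fun (A : C(K, G)) (γ : C(K, E)) =>
        (⟨fun t => B (A t) (γ t), by fun_prop⟩ : C(K, F)))
      (fun A A' γ => by ext t; simp) (fun c A γ => by ext t; simp)
      (fun A γ γ' => by ext t; simp) (fun c A γ => by ext t; simp)) ‖B‖
    (fun A γ => by
      rw [ContinuousMap.norm_le _ (by positivity)]
      intro t
      refine (B.le_opNorm₂ _ _).trans ?_
      gcongr
      exacts [A.norm_coe_le_norm t, γ.norm_coe_le_norm t])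

/-- The mean value inequality on the segment from `γ t` to `γ t + η t` bounds the remainder at `t`.
The bound is uniform in `t` because postcomposition with `f'` is continuous for the sup norm. -/
theorem hasFDerivAt_postcomp {E F G : Type*} [NormedAddCommGroup E] [NormedSpace ℝ E]
    [NormedAddCommGroup F] [NormedSpace ℝ F] [NormedAddCommGroup G] [NormedSpace ℝ G]
    (B : G →L[ℝ] E →L[ℝ] F) (hB : ∀ g, ‖B g‖ ≤ ‖g‖) (f : C(E, F)) (f' : C(E, G))
    (hf : ∀ x, HasFDerivAt f (B (f' x)) x) (γ : C(K, E)) :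
    HasFDerivAt (fun γ : C(K, E) => f.comp γ) (pointwiseBilin K B (f'.comp γ)) γ := by
  rw [hasFDerivAt_iff_isLittleO_nhds_zero, Asymptotics.isLittleO_iff]
  intro ε hε
  have hc : ContinuousAt (fun γ : C(K, E) => f'.comp γ) γ :=
    (ContinuousMap.continuous_postcomp f').continuousAt
  obtain ⟨δ, hδ, h⟩ := Metric.continuousAt_iff.1 hc ε hε
  filter_upwards [Metric.ball_mem_nhds (0 : C(K, E)) hδ] with η hη
  rw [ContinuousMap.norm_le _ (by positivity)]
  intro t
  have key := Convex.norm_image_sub_le_of_norm_hasFDerivWithin_le' (𝕜 := ℝ) (f := f) (C := ε)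
    (s := segment ℝ (γ t) (γ t + η t)) (x := γ t) (y := γ t + η t) (f' := fun x => B (f' x))
    (φ := B (f' (γ t)))
    (fun x _ => (hf x).hasFDerivWithinAt) (fun x hx => by
      rw [segment_eq_image'] at hx
      obtain ⟨s, hs, rfl⟩ := hx
      -- A point of the segment is the value at `t` of the curve `γ + s • η`, which lies in the
      -- `δ`-ball around `γ`.
      have hd : dist (γ + s • η) γ < δ := by
        rw [dist_eq_norm, add_sub_cancel_left, norm_smul, Real.norm_eq_abs, abs_of_nonneg hs.1]
        exact (mul_le_of_le_one_left (norm_nonneg _) hs.2).trans_lt (by simpa using hη)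
      have h3 := (ContinuousMap.dist_apply_le_dist (f := f'.comp (γ + s • η)) (g := f'.comp γ)
        t).trans (h hd).le
      rw [dist_eq_norm] at h3
      rw [← map_sub]
      refine (hB _).trans ?_
      simpa using h3)
    (convex_segment _ _) (left_mem_segment _ _ _) (right_mem_segment _ _ _)
  rw [add_sub_cancel_left] at key
  exact key.trans (mul_le_mul_of_nonneg_left (η.norm_coe_le_norm t) hε.le)

/-- The derivative at `γ` is pointwise application of `f' ∘ γ`: a bounded linear operator after the
superposition operator of `f'`, to which the induction applies. As `f'` takes values in `E →L[ℝ] F`,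
the target must vary in the induction, and the common universe keeps that space admissible. -/
theorem contDiff_postcomp_nat {E : Type u} [NormedAddCommGroup E] [NormedSpace ℝ E] (n : ℕ) :
    ∀ {F : Type u} [NormedAddCommGroup F] [NormedSpace ℝ F] (f : C(E, F)),
      ContDiff ℝ n f → ContDiff ℝ n (fun γ : C(K, E) => f.comp γ) := by
  induction n with
  | zero =>
    intro F _ _ f _
    exact contDiff_zero.2 (ContinuousMap.continuous_postcomp f)
  | succ n ih =>
    intro F _ _ f hf
    obtain ⟨f', hf', hd⟩ := contDiff_succ_iff_hasFDerivAt.1 (by exact_mod_cast hf)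
    let B : (E →L[ℝ] F) →L[ℝ] E →L[ℝ] F := ContinuousLinearMap.id ℝ _
    have h := (pointwiseBilin K B).contDiff.comp (ih ⟨f', hf'.continuous⟩ hf')
    have : ContDiff ℝ (n + 1) (fun γ : C(K, E) => f.comp γ) :=
      contDiff_succ_iff_hasFDerivAt.2 ⟨_, h,
        fun γ => hasFDerivAt_postcomp B (fun _ => le_rfl) f ⟨f', hf'.continuous⟩ hd γ⟩
    exact_mod_cast this

theorem contDiff_postcomp {E F : Type u} [NormedAddCommGroup E] [NormedSpace ℝ E]
    [NormedAddCommGroup F] [NormedSpace ℝ F] (f : C(E, F)) (hf : ContDiff ℝ ∞ f) :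
    ContDiff ℝ ∞ (fun γ : C(K, E) => f.comp γ) :=
  contDiff_infty.2 fun n => contDiff_postcomp_nat n f (contDiff_infty.1 hf n)

end Nemytskii

/-! ### Germs of smooth maps; inverse and implicit functions on neighbourhoods. -/

section SmoothNear

variable {E F G : Type*} [NormedAddCommGroup E] [NormedSpace ℝ E]
  [NormedAddCommGroup F] [NormedSpace ℝ F] [NormedAddCommGroup G] [NormedSpace ℝ G]

/-- `f` is smooth on a neighbourhood of `x`. -/
def SmoothNear (f : E → F) (x : E) : Prop := ∀ᶠ y in 𝓝 x, ContDiffAt ℝ ∞ f y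

theorem ContDiff.smoothNear {f : E → F} (hf : ContDiff ℝ ∞ f) (x : E) : SmoothNear f x :=
  Filter.Eventually.of_forall fun _ => hf.contDiffAt

theorem SmoothNear.contDiffAt {f : E → F} {x : E} (hf : SmoothNear f x) : ContDiffAt ℝ ∞ f x :=
  hf.self_of_nhds

theorem SmoothNear.continuousAt {f : E → F} {x : E} (hf : SmoothNear f x) : ContinuousAt f x :=
  hf.contDiffAt.continuousAt

theorem SmoothNear.tendsto {f : E → F} {x : E} {y : F} (hf : SmoothNear f x) (h : f x = y) :
    Filter.Tendsto f (𝓝 x) (𝓝 y) :=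
  h ▸ hf.continuousAt

theorem SmoothNear.differentiableAt {f : E → F} {x : E} (hf : SmoothNear f x) :
    DifferentiableAt ℝ f x :=
  hf.contDiffAt.differentiableAt (by simp)

theorem SmoothNear.fderiv {f : E → F} {x : E} (hf : SmoothNear f x) :
    SmoothNear (fderiv ℝ f) x :=
  Filter.Eventually.mono hf fun _ hy => hy.fderiv_right (by simp)

theorem SmoothNear.comp {g : F → G} {f : E → F} {x : E} (hg : SmoothNear g (f x))
    (hf : SmoothNear f x) : SmoothNear (fun y => g (f y)) x := by
  filter_upwards [hf, hf.continuousAt.eventually hg] with y hy hy'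
  exact ContDiffAt.comp y hy' hy

theorem SmoothNear.comp' {g : F → G} {f : E → F} {x : E} {y : F} (hg : SmoothNear g y)
    (hf : SmoothNear f x) (hy : f x = y) : SmoothNear (fun y => g (f y)) x :=
  SmoothNear.comp (hy ▸ hg) hf

theorem SmoothNear.prodMk {f : E → F} {g : E → G} {x : E} (hf : SmoothNear f x)
    (hg : SmoothNear g x) : SmoothNear (fun y => (f y, g y)) x := by
  filter_upwards [hf, hg] with y h1 h2 using h1.prodMk h2

theorem SmoothNear.clm_apply {f : E → F →L[ℝ] G} {g : E → F} {x : E} (hf : SmoothNear f x)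
    (hg : SmoothNear g x) : SmoothNear (fun y => f y (g y)) x := by
  filter_upwards [hf, hg] with y h1 h2 using h1.clm_apply h2

/-- The inverse function theorem on a neighbourhood. -/
theorem SmoothNear.exists_openPartialHomeomorph [CompleteSpace E] {f : E → F} {x : E}
    (hf : SmoothNear f x) (f' : E ≃L[ℝ] F) (hf' : HasFDerivAt f (f' : E →L[ℝ] F) x)
    {s : Set E} (hs : s ∈ 𝓝 x) :
    ∃ Φ : OpenPartialHomeomorph E F, ⇑Φ = f ∧ x ∈ Φ.source ∧ Φ.source ⊆ s ∧
      (∀ y ∈ Φ.source, ContDiffAt ℝ ∞ Φ y) ∧ (∀ z ∈ Φ.target, ContDiffAt ℝ ∞ Φ.symm z) := by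
  -- Invertibility of the derivative is an open condition; it makes the inverse smooth on the whole
  -- target and not only at `f x`.
  have hinv : ∀ᶠ y in 𝓝 x, ∃ e : E ≃L[ℝ] F, (e : E →L[ℝ] F) = _root_.fderiv ℝ f y := by
    have h := hf.fderiv.continuousAt
    have h2 := f'.nhds
    rw [← hf'.fderiv] at h2
    exact h h2
  set Φ₀ := hf.contDiffAt.toOpenPartialHomeomorph f hf' (by simp) with hΦ₀
  have hcoe : ⇑Φ₀ = f := hf.contDiffAt.toOpenPartialHomeomorph_coe hf' (by simp)
  have hx : x ∈ Φ₀.source := hf.contDiffAt.mem_toOpenPartialHomeomorph_source hf' (by simp)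
  obtain ⟨t, ht, hto, hxt⟩ := mem_nhds_iff.1
    (Filter.inter_mem hs (Filter.inter_mem hf hinv))
  set Φ := Φ₀.restrOpen t hto
  have hcoe' : ⇑Φ = f := hcoe
  have hsrc : Φ.source = Φ₀.source ∩ t := Φ₀.restrOpen_source t hto
  refine ⟨Φ, hcoe', hsrc ▸ ⟨hx, hxt⟩, fun y hy => ?_, fun y hy => ?_, fun z hz => ?_⟩
  · rw [hsrc] at hy
    exact (ht hy.2).1
  · rw [hsrc] at hy
    rw [hcoe']
    exact (ht hy.2).2.1
  · have hy := Φ.map_target hz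
    rw [hsrc] at hy
    obtain ⟨-, h1, e, he⟩ := ht hy.2
    replace h1 : ContDiffAt ℝ ∞ f (Φ.symm z) := h1
    refine Φ.contDiffAt_symm hz (f₀' := e) ?_ (hcoe' ▸ h1)
    rw [he, hcoe']
    exact (h1.differentiableAt (by simp)).hasFDerivAt

/-- The implicit function theorem on a neighbourhood. -/
theorem SmoothNear.exists_implicitFunction [CompleteSpace E] [CompleteSpace F]
    {f : E × F → G} {x : E} {y : F} (hf : SmoothNear f (x, y)) (f' : F ≃L[ℝ] G)
    (hf' : HasFDerivAt (fun z => f (x, z)) (f' : F →L[ℝ] G) y) :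
    ∃ ψ : E → F, SmoothNear ψ x ∧ ψ x = y ∧
      ∀ᶠ p : E × F in 𝓝 (x, y), f p = f (x, y) ↔ p.2 = ψ p.1 := by
  set f₁ : E →L[ℝ] G := (_root_.fderiv ℝ f (x, y)).comp (ContinuousLinearMap.inl ℝ E F)
  have hd := hf.differentiableAt.hasFDerivAt
  have h2 : (_root_.fderiv ℝ f (x, y)).comp (ContinuousLinearMap.inr ℝ E F) = f' := by
    refine HasFDerivAt.unique ?_ hf'
    exact hd.comp y (hasFDerivAt_prodMk_right x y)
  have hsum : ∀ v w, _root_.fderiv ℝ f (x, y) (v, w) = f₁ v + f' w := by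
    intro v w
    have e : ((v, w) : E × F) = (v, 0) + (0, w) := by simp
    rw [e, map_add]
    congr 1
    exact DFunLike.congr_fun h2 w
  -- The derivative of `(z, w) ↦ (z, f (z, w))` is block triangular, with inverse `(v, w) ↦ (v, f'⁻¹
  -- (w - f₁ v))`.
  let A : (E × F) ≃L[ℝ] (E × G) := ContinuousLinearEquiv.equivOfInverse
    ((ContinuousLinearMap.fst ℝ E F).prod (_root_.fderiv ℝ f (x, y)))
    ((ContinuousLinearMap.fst ℝ E G).prod ((f'.symm : G →L[ℝ] F).comp
      (ContinuousLinearMap.snd ℝ E G - f₁.comp (ContinuousLinearMap.fst ℝ E G))))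
    (fun p => by
      obtain ⟨v, w⟩ := p
      simp [hsum])
    (fun p => by
      obtain ⟨v, w⟩ := p
      simp [hsum])
  have hS : SmoothNear (fun p : E × F => (p.1, f p)) (x, y) :=
    (ContDiff.smoothNear contDiff_fst _).prodMk hf
  have hA : HasFDerivAt (fun p : E × F => (p.1, f p)) (A : (E × F) →L[ℝ] (E × G)) (x, y) :=
    hasFDerivAt_fst.prodMk hd
  obtain ⟨Φ, hΦ, hmem, -, hsm, hsm'⟩ := hS.exists_openPartialHomeomorph A hA Filter.univ_mem
  have hΦ' : ∀ p, Φ p = (p.1, f p) := fun p => by rw [hΦ]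
  set c := f (x, y)
  have htgt : (x, c) ∈ Φ.target := by
    have := Φ.map_source hmem
    rwa [hΦ'] at this
  have hsymm : Φ.symm (x, c) = (x, y) := by
    rw [← Φ.left_inv hmem, hΦ']
  have hcont : ContinuousAt (fun z : E => ((z, c) : E × G)) x := by fun_prop
  have hev : ∀ᶠ z in 𝓝 x, (z, c) ∈ Φ.target := hcont (Φ.open_target.mem_nhds htgt)
  refine ⟨fun z => (Φ.symm (z, c)).2, ?_, by simp [hsymm], ?_⟩
  · filter_upwards [hev] with z hz
    have h3 : ContDiffAt ℝ ∞ (fun z : E => ((z, c) : E × G)) z := by fun_prop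
    exact contDiffAt_snd.comp z (ContDiffAt.comp z (hsm' _ hz) h3)
  · have hfst : ∀ᶠ p : E × F in 𝓝 (x, y), (p.1, c) ∈ Φ.target :=
      (continuous_fst.tendsto (x, y)).eventually hev
    filter_upwards [hfst, Φ.open_source.mem_nhds hmem] with p hp hps
    constructor
    · intro h
      have : Φ p = (p.1, c) := by rw [hΦ', h]
      rw [← this, Φ.left_inv hps]
    · intro h
      have e1 := Φ.right_inv hp
      rw [hΦ'] at e1
      have e2 : (Φ.symm (p.1, c)) = p := Prod.ext (Prod.ext_iff.1 e1).1 h.symm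
      rw [e2] at e1
      exact (Prod.ext_iff.1 e1).2

end SmoothNear

/-! ### Smooth flows from the integral equation for curves. -/

section Flow

universe u

variable {E : Type u} [NormedAddCommGroup E]

/-- The extension of a curve on `[-1, 1]` to the real line, constant outside of the interval. -/
noncomputable def extendCurve (γ : C(Set.Icc (-1 : ℝ) 1, E)) (s : ℝ) : E :=
  γ (Set.projIcc (-1) 1 (by norm_num) s)

theorem continuous_extendCurve (γ : C(Set.Icc (-1 : ℝ) 1, E)) : Continuous (extendCurve γ) :=
  γ.continuous.comp continuous_projIcc

theorem extendCurve_of_mem (γ : C(Set.Icc (-1 : ℝ) 1, E)) {s : ℝ} (hs : s ∈ Set.Icc (-1 : ℝ) 1) :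
    extendCurve γ s = γ ⟨s, hs⟩ := by
  rw [extendCurve, Set.projIcc_of_mem _ hs]

variable [NormedSpace ℝ E]

/-- The Volterra operator `γ ↦ ∫₀ᵗ γ` on curves over `[-1, 1]`. -/
noncomputable def volterra (E : Type u) [NormedAddCommGroup E] [NormedSpace ℝ E] :
    C(Set.Icc (-1 : ℝ) 1, E) →L[ℝ] C(Set.Icc (-1 : ℝ) 1, E) :=
  LinearMap.mkContinuous
    { toFun := fun γ => ⟨fun t => ∫ s in (0 : ℝ)..t, extendCurve γ s,
        (intervalIntegral.continuous_primitive
          (fun a b => (continuous_extendCurve γ).intervalIntegrable a b) 0).comp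
          continuous_subtype_val⟩
      map_add' := fun γ γ' => by
        ext t
        exact intervalIntegral.integral_add ((continuous_extendCurve γ).intervalIntegrable _ _)
          ((continuous_extendCurve γ').intervalIntegrable _ _)
      map_smul' := fun c γ => by
        ext t
        exact intervalIntegral.integral_smul c _ }
    1 (fun γ => by
      rw [ContinuousMap.norm_le _ (by positivity)]
      intro t
      refine (intervalIntegral.norm_integral_le_of_norm_le_const
        (fun s _ => γ.norm_coe_le_norm _)).trans ?_
      rw [sub_zero, mul_comm]
      exact mul_le_mul_of_nonneg_right (abs_le.2 t.2) (norm_nonneg _))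

theorem volterra_apply (γ : C(Set.Icc (-1 : ℝ) 1, E)) (t : Set.Icc (-1 : ℝ) 1) :
    volterra E γ t = ∫ s in (0 : ℝ)..t, extendCurve γ s := rfl

/-- The precomposition of a curve with the contraction `t ↦ s t`, for `|s| ≤ 1`. -/
noncomputable def rescaleCurve (γ : C(Set.Icc (-1 : ℝ) 1, E)) (s : Set.Icc (-1 : ℝ) 1) :
    C(Set.Icc (-1 : ℝ) 1, E) :=
  γ.comp ⟨fun t => ⟨s * t, by
    rw [Set.mem_Icc, ← abs_le, abs_mul]
    exact mul_le_one₀ (abs_le.2 s.2) (abs_nonneg _) (abs_le.2 t.2)⟩, by fun_prop⟩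

/-- Substitution `r ↦ s r`. Consequently, slowing down a solution of `γ = x + τ ∫ f(γ)` by `s` gives
a solution for the parameter `s τ`. -/
theorem volterra_rescaleCurve (γ : C(Set.Icc (-1 : ℝ) 1, E)) (s t : Set.Icc (-1 : ℝ) 1) :
    (s : ℝ) • volterra E (rescaleCurve γ s) t = ∫ r in (0 : ℝ)..(s * t : ℝ), extendCurve γ r := by
  rw [volterra_apply]
  have h : ∫ r in (0 : ℝ)..t, extendCurve (rescaleCurve γ s) r
      = ∫ r in (0 : ℝ)..t, extendCurve γ (s * r) := by
    refine intervalIntegral.integral_congr fun r hr => ?_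
    have hr' : r ∈ Set.Icc (-1 : ℝ) 1 :=
      (Set.ordConnected_Icc.uIcc_subset (by norm_num) t.2) hr
    have hsr : (s * r : ℝ) ∈ Set.Icc (-1 : ℝ) 1 := by
      rw [Set.mem_Icc, ← abs_le, abs_mul]
      exact mul_le_one₀ (abs_le.2 s.2) (abs_nonneg _) (abs_le.2 hr')
    change extendCurve _ r = extendCurve _ _
    rw [extendCurve_of_mem _ hr', extendCurve_of_mem _ hsr]
    rfl
  rw [h, intervalIntegral.smul_integral_comp_mul_left, mul_zero]

variable [CompleteSpace E]

/-- Smooth dependence of the solutions of an autonomous differential equation on time and on the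
initial value. -/
theorem exists_smooth_flow {f : E → E} (hf : ContDiff ℝ ∞ f) (x₀ : E) :
    ∃ φ : ℝ × E → E, SmoothNear φ (0, x₀) ∧ (∀ᶠ x in 𝓝 x₀, φ (0, x) = x) ∧
      ∀ᶠ p : ℝ × E in 𝓝 (0, x₀), HasDerivAt (fun s => φ (s, p.2)) (f (φ p)) p.1 := by
  let fc : C(E, E) := ⟨f, hf.continuous⟩
  let N : C(Set.Icc (-1 : ℝ) 1, E) → C(Set.Icc (-1 : ℝ) 1, E) := fun γ => fc.comp γ
  have hN : ContDiff ℝ ∞ N := contDiff_postcomp fc hf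
  let cst : E →L[ℝ] C(Set.Icc (-1 : ℝ) 1, E) := LinearMap.mkContinuous
    { toFun := fun x => ContinuousMap.const _ x
      map_add' := fun _ _ => rfl
      map_smul' := fun _ _ => rfl } 1 (fun x => by
        rw [ContinuousMap.norm_le _ (by positivity)]
        intro t
        rw [one_mul]
        exact le_rfl)
  -- A zero of `G` is a trajectory with time rescaled by `τ`: `γ t = x + τ ∫₀ᵗ f(γ)`. At `τ = 0` the
  -- integral disappears, so the derivative in `γ` is the identity and the implicit function theorem
  -- applies without any estimate on `f`.
  let G : (ℝ × E) × C(Set.Icc (-1 : ℝ) 1, E) → C(Set.Icc (-1 : ℝ) 1, E) :=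
    fun p => p.2 - cst p.1.2 - p.1.1 • volterra E (N p.2)
  have hG : ContDiff ℝ ∞ G := by
    refine ContDiff.sub (ContDiff.sub contDiff_snd (cst.contDiff.comp (contDiff_snd.comp contDiff_fst))) ?_
    exact ContDiff.smul (contDiff_fst.comp contDiff_fst) ((volterra E).contDiff.comp (hN.comp contDiff_snd))
  have hG0 : G ((0, x₀), cst x₀) = 0 := by simp [G]
  have hGd : HasFDerivAt (fun γ => G ((0, x₀), γ))
      ((ContinuousLinearEquiv.refl ℝ C(Set.Icc (-1 : ℝ) 1, E) :
        C(Set.Icc (-1 : ℝ) 1, E) ≃L[ℝ] C(Set.Icc (-1 : ℝ) 1, E)) :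
        C(Set.Icc (-1 : ℝ) 1, E) →L[ℝ] C(Set.Icc (-1 : ℝ) 1, E)) (cst x₀) := by
    have : (fun γ => G ((0, x₀), γ)) = fun γ => γ - cst x₀ := by
      funext γ
      simp [G]
    rw [this]
    exact (hasFDerivAt_id _).sub_const _
  obtain ⟨ψ, hψ, hψ0, hiff⟩ := SmoothNear.exists_implicitFunction
    (hG.smoothNear ((0, x₀), cst x₀)) _ hGd
  rw [hG0] at hiff
  obtain ⟨δ, hδ, hball⟩ := Metric.eventually_nhds_iff.1 hiff
  have hnear : ∀ᶠ p in 𝓝 ((0 : ℝ), x₀), dist (ψ p) (cst x₀) < δ := by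
    have := hψ.continuousAt (Metric.ball_mem_nhds _ hδ)
    rwa [hψ0] at this
  obtain ⟨δ', hδ', hball'⟩ := Metric.eventually_nhds_iff.1
    (hnear.and (Metric.ball_mem_nhds ((0 : ℝ), x₀) hδ))
  have hsol : ∀ p : ℝ × E, dist p (0, x₀) < δ' → G (p, ψ p) = 0 := fun p hp => by
    refine (hball (y := (p, ψ p)) ?_).2 rfl
    rw [Prod.dist_eq]
    exact max_lt (hball' hp).2 (hball' hp).1
  have hsol' : ∀ (τ : ℝ) (x : E), dist ((τ, x) : ℝ × E) (0, x₀) < δ' →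
      ∀ t, ψ (τ, x) t = x + τ • volterra E (N (ψ (τ, x))) t := fun τ x hp t => by
    have h := DFunLike.congr_fun (hsol _ hp) t
    have h' : ψ (τ, x) t - x - τ • volterra E (N (ψ (τ, x))) t = 0 := h
    rw [sub_sub, sub_eq_zero] at h'
    exact h'
  -- The rescaled curve solves the equation for `s τ` and stays close to the constant curve, so
  -- local uniqueness identifies it with `ψ (s τ, x)`. Evaluation at `1` then recovers whole
  -- trajectories.
  have hscale : ∀ (τ : ℝ) (x : E), dist ((τ, x) : ℝ × E) (0, x₀) < δ' →
      ∀ s : Set.Icc (-1 : ℝ) 1, rescaleCurve (ψ (τ, x)) s = ψ (s * τ, x) := by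
    intro τ x hp s
    have hp' : dist ((s * τ, x) : ℝ × E) (0, x₀) < δ' := by
      refine lt_of_le_of_lt ?_ hp
      simp only [Prod.dist_eq, dist_zero_right, norm_mul, Real.norm_eq_abs]
      exact max_le_max (mul_le_of_le_one_left (abs_nonneg _) (abs_le.2 s.2)) le_rfl
    refine (hball (y := ((s * τ, x), rescaleCurve (ψ (τ, x)) s)) ?_).1 ?_
    · rw [Prod.dist_eq]
      refine max_lt (hball' hp').2 (lt_of_le_of_lt ?_ (hball' hp).1)
      rw [ContinuousMap.dist_le dist_nonneg]
      intro t
      exact ContinuousMap.dist_apply_le_dist (f := ψ (τ, x)) (g := cst x₀) _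
    · ext t
      change rescaleCurve (ψ (τ, x)) s t - x - (s * τ : ℝ) • volterra E
        (rescaleCurve (N (ψ (τ, x))) s) t = 0
      rw [mul_comm, mul_smul, volterra_rescaleCurve, sub_sub, sub_eq_zero]
      exact hsol' τ x hp _
  have one_mem : (1 : ℝ) ∈ Set.Icc (-1 : ℝ) 1 := by norm_num
  have hφ : ∀ (τ : ℝ) (x : E), dist ((τ, x) : ℝ × E) (0, x₀) < δ' →
      ∀ s : Set.Icc (-1 : ℝ) 1, ψ (s * τ, x) ⟨1, one_mem⟩ = ψ (τ, x) s := by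
    intro τ x hp s
    rw [← hscale τ x hp s]
    exact congrArg (ψ (τ, x)) (Subtype.ext (mul_one _))
  refine ⟨fun p => ψ p ⟨1, one_mem⟩, ?_, ?_, ?_⟩
  · let ev : C(Set.Icc (-1 : ℝ) 1, E) →L[ℝ] E := ContinuousMap.evalCLM ℝ ⟨1, one_mem⟩
    exact SmoothNear.comp (g := ev) (ev.contDiff.smoothNear _) hψ
  · filter_upwards [Metric.ball_mem_nhds x₀ hδ'] with x hx
    rw [hsol' 0 x (by simpa [Prod.dist_eq, hδ'] using hx), zero_smul, add_zero]
  · have hc : 0 < δ' / 2 := by positivity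
    filter_upwards [Metric.ball_mem_nhds ((0 : ℝ), x₀) hc] with p hp
    obtain ⟨τ, x⟩ := p
    rw [Metric.mem_ball, Prod.dist_eq, max_lt_iff, dist_zero_right, Real.norm_eq_abs] at hp
    set c := δ' / 2 with hcdef
    have hcx : dist ((c, x) : ℝ × E) (0, x₀) < δ' := by
      rw [Prod.dist_eq, dist_zero_right, Real.norm_eq_abs, abs_of_pos hc]
      exact max_lt (by linarith) (by have := hp.2; simp only at this; linarith)
    have hmem : ∀ σ : ℝ, |σ| < c → σ / c ∈ Set.Icc (-1 : ℝ) 1 := fun σ hσ => by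
      rw [Set.mem_Icc, ← abs_le, abs_div, abs_of_pos hc]
      exact (div_le_one hc).2 hσ.le
    -- For all `|σ| < c` the value is read off the single curve `ψ (c, x)` at `σ / c`, so the
    -- fundamental theorem of calculus gives the derivative in `σ`.
    have heq : ∀ σ : ℝ, |σ| < c → ψ (σ, x) ⟨1, one_mem⟩ =
        x + c • ∫ r in (0 : ℝ)..(σ / c), extendCurve (N (ψ (c, x))) r := fun σ hσ => by
      have h1 := hφ c x hcx ⟨σ / c, hmem σ hσ⟩
      simp only [div_mul_cancel₀ _ hc.ne'] at h1
      rw [h1]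
      exact hsol' c x hcx _
    have hev : (fun σ => ψ (σ, x) ⟨1, one_mem⟩) =ᶠ[𝓝 τ] fun σ =>
        x + c • ∫ r in (0 : ℝ)..(σ / c), extendCurve (N (ψ (c, x))) r := by
      filter_upwards [(isOpen_lt continuous_abs continuous_const).mem_nhds hp.1] with σ hσ
      exact heq σ hσ
    have hcE := continuous_extendCurve (N (ψ (c, x)))
    have hint := intervalIntegral.integral_hasDerivAt_right
      (hcE.intervalIntegrable 0 (τ / c)) (hcE.stronglyMeasurableAtFilter _ _) hcE.continuousAt
    have hder := ((hint.scomp τ ((hasDerivAt_id τ).div_const c)).const_smul c).const_add x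
    refine (hder.congr_of_eventuallyEq hev).congr_deriv ?_
    rw [smul_smul, mul_one_div_cancel hc.ne', one_smul, extendCurve_of_mem _ (hmem τ hp.1)]
    have h1 := hφ c x hcx ⟨τ / c, hmem τ hp.1⟩
    simp only [div_mul_cancel₀ _ hc.ne'] at h1
    rw [h1]
    rfl

end Flow

/-! ### Local flows and projection onto a transverse hypersurface. -/

section FlowProjection

variable {E : Type*} [NormedAddCommGroup E] [NormedSpace ℝ E] [FiniteDimensional ℝ E]

/-- Cutting off makes a local vector field globally defined and globally Lipschitz, as the
uniqueness argument for its flow uses. -/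
theorem SmoothNear.exists_contDiff_hasCompactSupport {F : Type*} [NormedAddCommGroup F]
    [NormedSpace ℝ F] {f : E → F} {x₀ : E} (hf : SmoothNear f x₀) :
    ∃ g : E → F, ContDiff ℝ ∞ g ∧ HasCompactSupport g ∧ g =ᶠ[𝓝 x₀] f := by
  obtain ⟨δ, hδ, hball⟩ := Metric.eventually_nhds_iff.1 hf
  let b : ContDiffBump x₀ := ⟨δ / 4, δ / 2, by positivity, by linarith⟩
  refine ⟨fun x => b x • f x, ?_, b.hasCompactSupport.smul_right, ?_⟩
  · rw [contDiff_iff_contDiffAt]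
    intro x
    by_cases hx : dist x x₀ < δ
    · exact b.contDiff.contDiffAt.smul (hball hx)
    · have hx' : x ∉ tsupport b := by
        rw [b.tsupport_eq, Metric.mem_closedBall]
        change ¬ dist x x₀ ≤ δ / 2
        linarith
      have h0 : (fun x => b x • f x) =ᶠ[𝓝 x] fun _ => 0 := by
        filter_upwards [notMem_tsupport_iff_eventuallyEq.1 hx'] with y hy
        rw [hy, Pi.zero_apply, zero_smul]
      exact contDiffAt_const.congr_of_eventuallyEq h0
  · filter_upwards [b.eventuallyEq_one] with x hx
    rw [hx, Pi.one_apply, one_smul]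

/-- A smooth vector field on a neighbourhood of a point has a smooth local flow, and the flow
preserves the vector field. -/
theorem exists_smooth_local_flow {X : E → E} {x₀ : E} (hX : SmoothNear X x₀) :
    ∃ φ : ℝ × E → E, SmoothNear φ (0, x₀) ∧ (∀ᶠ x in 𝓝 x₀, φ (0, x) = x) ∧
      ∀ᶠ p : ℝ × E in 𝓝 (0, x₀), fderiv ℝ φ p (1, 0) = X (φ p) ∧
        fderiv ℝ φ p (0, X p.2) = X (φ p) := by
  obtain ⟨g, hg, hgc, hgX⟩ := hX.exists_contDiff_hasCompactSupport
  obtain ⟨K, hK⟩ := hg.lipschitzWith_of_hasCompactSupport hgc (by simp)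
  obtain ⟨φ, hφ, hφ0, hφd⟩ := exists_smooth_flow hg x₀
  refine ⟨φ, hφ, hφ0, ?_⟩
  have hφx : φ (0, x₀) = x₀ := hφ0.self_of_nhds
  obtain ⟨δ₁, hδ₁, h₁⟩ := Metric.eventually_nhds_iff.1 hφ0
  obtain ⟨δ₂, hδ₂, h₂⟩ := Metric.eventually_nhds_iff.1 (hφd.and hφ)
  set δ := min δ₁ δ₂
  have hδ : 0 < δ := lt_min hδ₁ hδ₂
  have hid : ∀ x, dist x x₀ < δ → φ (0, x) = x := fun x hx => h₁ (hx.trans_le (min_le_left _ _))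
  have hder : ∀ (s : ℝ) (x : E), |s| < δ → dist x x₀ < δ →
      HasDerivAt (fun s => φ (s, x)) (g (φ (s, x))) s := fun s x hs hx => by
    refine (h₂ (y := (s, x)) ?_).1
    rw [Prod.dist_eq, dist_zero_right]
    exact max_lt (hs.trans_le (min_le_right _ _)) (hx.trans_le (min_le_right _ _))
  have hgroup : ∀ (t s : ℝ) (x : E), |t| < δ / 2 → |s| < δ / 2 → dist x x₀ < δ →
      dist (φ (t, x)) x₀ < δ → φ (s, φ (t, x)) = φ (s + t, x) := by
    intro t s x ht hs hx htx
    -- Both sides, as functions of `s`, solve the equation of the Lipschitz field `g` with value `φ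
    -- (t, x)` at `s = 0`.
    refine ODE_solution_unique_of_mem_Ioo (v := fun _ => g) (s := fun _ => Set.univ)
      (f := fun s => φ (s, φ (t, x))) (g := fun s => φ (s + t, x))
      (a := -(δ / 2)) (b := δ / 2) (t₀ := 0) (fun _ _ => hK.lipschitzOnWith)
      ⟨by linarith, by linarith⟩ (fun r hr => ⟨?_, trivial⟩) (fun r hr => ⟨?_, trivial⟩) ?_
      (abs_lt.1 hs)
    · exact hder r _ ((abs_lt.2 hr).trans (by linarith)) htx
    · have hrt : |r + t| < δ := (abs_add_le _ _).trans_lt (by linarith [abs_lt.2 hr])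
      exact (hder (r + t) x hrt hx).comp_add_const r t
    · simp only [zero_add]
      exact hid _ htx
  have hc1 : ∀ᶠ p : ℝ × E in 𝓝 (0, x₀), |p.1| < δ / 2 :=
    (isOpen_lt (by fun_prop) continuous_const).mem_nhds (by simpa using hδ)
  have hc2 : ∀ᶠ p : ℝ × E in 𝓝 (0, x₀), dist p.2 x₀ < δ :=
    (isOpen_lt (by fun_prop) continuous_const).mem_nhds (by simpa using hδ)
  have hc3 : ∀ᶠ p : ℝ × E in 𝓝 (0, x₀), ∀ᶠ t in 𝓝 (0 : ℝ), dist (φ (t, p.2)) x₀ < δ := by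
    have h4 : ∀ᶠ p : ℝ × E in 𝓝 (0, x₀), ∀ᶠ q in 𝓝 p, dist (φ q) x₀ < δ :=
      eventually_eventually_nhds.2
        ((hφ.tendsto hφx).eventually (Metric.ball_mem_nhds _ hδ))
    have h5 : Filter.Tendsto (fun p : ℝ × E => ((0 : ℝ), p.2)) (𝓝 (0, x₀)) (𝓝 (0, x₀)) :=
      Continuous.tendsto' (by fun_prop) _ _ rfl
    filter_upwards [h5.eventually h4] with p hp
    exact (Continuous.tendsto' (f := fun t : ℝ => (t, p.2)) (by fun_prop) 0 _ rfl).eventually hp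
  have hc4 : ∀ᶠ p : ℝ × E in 𝓝 (0, x₀), g (φ p) = X (φ p) :=
    (hφ.tendsto hφx).eventually hgX
  have hc5 : ∀ᶠ p : ℝ × E in 𝓝 (0, x₀), g p.2 = X p.2 :=
    (continuous_snd.tendsto ((0 : ℝ), x₀)).eventually hgX
  filter_upwards [hφ, hc1, hc2, hc3, hc4, hc5] with p h6 h7 h8 h9 h10 h11
  obtain ⟨s, x⟩ := p
  simp only at h7 h8 h9 h11
  have hd : HasFDerivAt φ (fderiv ℝ φ (s, x)) (s, x) :=
    (h6.differentiableAt (by simp)).hasFDerivAt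
  refine ⟨?_, ?_⟩
  · rw [← h10]
    have ha : HasDerivAt (fun s : ℝ => (s, x)) ((1 : ℝ), (0 : E)) s :=
      (hasDerivAt_id s).prodMk (hasDerivAt_const s x)
    exact (hd.comp_hasDerivAt s ha).unique (hder s x (by linarith) h8)
  -- Invariance of the field: differentiate the group law `φ (s, φ (t, x)) = φ (s + t, x)` in `t` at
  -- `t = 0`.
  · rw [← h10, ← h11]
    have hx0 := hid x h8
    have h12 := hder 0 x (by simpa using hδ) h8
    have ha : HasDerivAt (fun t : ℝ => (s, φ (t, x))) ((0 : ℝ), g x) 0 := by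
      refine (hasDerivAt_const 0 s).prodMk ?_
      rwa [hx0] at h12
    have hd' : HasFDerivAt φ (fderiv ℝ φ (s, x)) (s, φ (0, x)) := by rwa [hx0]
    have hL := hd'.comp_hasDerivAt (0 : ℝ) ha
    have hR : HasDerivAt (fun t => φ (s + t, x)) (g (φ (s, x))) 0 := by
      have := hder s x (by linarith) h8
      rw [← add_zero s] at this
      simpa using this.comp_const_add s 0
    refine hL.unique (hR.congr_of_eventuallyEq ?_)
    have ht : ∀ᶠ t : ℝ in 𝓝 0, |t| < δ / 2 :=
      (isOpen_lt continuous_abs continuous_const).mem_nhds (by simpa using hδ)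
    filter_upwards [h9, ht] with t ht1 ht2
    exact hgroup t s x ht2 h7 h8 ht1

/-- For a vector field `X` transverse to the hypersurface `u = 0`, the time `-τ` and the end point
`π` at which the trajectories of `X` meet this hypersurface. -/
theorem exists_flow_projection {X : E → E} {u : E → ℝ} {x₀ : E}
    (hX : SmoothNear X x₀) (hu : SmoothNear u x₀) (hu0 : u x₀ = 0)
    (huX : fderiv ℝ u x₀ (X x₀) ≠ 0) :
    ∃ (τ : E → ℝ) (π : E → E), SmoothNear τ x₀ ∧ SmoothNear π x₀ ∧ τ x₀ = 0 ∧ π x₀ = x₀ ∧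
      (∀ᶠ x in 𝓝 x₀, u (π x) = 0) ∧
      (∀ᶠ x in 𝓝 x₀, fderiv ℝ τ x (X x) = -1 ∧ fderiv ℝ π x (X x) = 0) ∧
      (∀ᶠ x in 𝓝 x₀, u x = 0 → π x = x ∧
        ∀ v, fderiv ℝ u x v = 0 → fderiv ℝ τ x v = 0 ∧ fderiv ℝ π x v = v) ∧
      ∀ k : E → ℝ, SmoothNear k x₀ → (∀ᶠ x in 𝓝 x₀, fderiv ℝ k x (X x) = 0) →
        ∀ᶠ x in 𝓝 x₀, k (π x) = k x := by
  obtain ⟨φ, hφ, hφ0, hφd⟩ := exists_smooth_local_flow hX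
  have hφx : φ (0, x₀) = x₀ := hφ0.self_of_nhds
  have hswap : SmoothNear (fun p : E × ℝ => (p.2, p.1)) (x₀, 0) :=
    ContDiff.smoothNear (contDiff_snd.prodMk contDiff_fst) _
  have huφ : SmoothNear (fun p : E × ℝ => u (φ (p.2, p.1))) (x₀, 0) :=
    SmoothNear.comp' (g := u) hu (SmoothNear.comp (g := φ) hφ hswap) hφx
  have hdt : HasFDerivAt (fun t : ℝ => u (φ (t, x₀)))
      ((ContinuousLinearEquiv.unitsEquivAut ℝ (Units.mk0 _ huX) : ℝ ≃L[ℝ] ℝ) : ℝ →L[ℝ] ℝ) 0 := by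
    have ha : HasDerivAt (fun s : ℝ => (s, x₀)) ((1 : ℝ), (0 : E)) 0 :=
      (hasDerivAt_id 0).prodMk (hasDerivAt_const 0 x₀)
    have h1 := hφ.differentiableAt.hasFDerivAt.comp_hasDerivAt (0 : ℝ) ha
    rw [(hφd.self_of_nhds).1, hφx] at h1
    have h2 : HasFDerivAt u (fderiv ℝ u x₀) ((φ ∘ fun s : ℝ => (s, x₀)) 0) := by
      rw [Function.comp_apply, hφx]
      exact hu.differentiableAt.hasFDerivAt
    have h3 := (h2.comp_hasDerivAt (0 : ℝ) h1).hasFDerivAt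
    refine h3.congr_fderiv ?_
    ext
    simp
  -- Transversality lets `u (φ (t, x)) = 0` be solved for the hitting time `t = τ x`; the projection
  -- is `π x = φ (τ x, x)`.
  obtain ⟨τ, hτ, hτ0, hiff⟩ := huφ.exists_implicitFunction _ hdt
  simp only [hφx, hu0] at hiff
  have hpair : SmoothNear (fun x => (τ x, x)) x₀ :=
    hτ.prodMk (ContDiff.smoothNear contDiff_id _)
  have hpair0 : (τ x₀, x₀) = ((0 : ℝ), x₀) := by rw [hτ0]
  have hπ : SmoothNear (fun x => φ (τ x, x)) x₀ := SmoothNear.comp' (g := φ) hφ hpair hpair0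
  have hπ0 : φ (τ x₀, x₀) = x₀ := by rw [hτ0, hφx]
  have htend : Filter.Tendsto (fun x => (τ x, x)) (𝓝 x₀) (𝓝 (0, x₀)) :=
    hpair.tendsto hpair0
  have hπtend : Filter.Tendsto (fun x => φ (τ x, x)) (𝓝 x₀) (𝓝 x₀) :=
    hπ.tendsto hπ0
  have huπ : ∀ᶠ x in 𝓝 x₀, u (φ (τ x, x)) = 0 := by
    have h1 : Filter.Tendsto (fun x => (x, τ x)) (𝓝 x₀) (𝓝 (x₀, 0)) :=
      (continuous_swap.tendsto ((0 : ℝ), x₀)).comp htend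
    filter_upwards [h1.eventually hiff] with x hx
    exact hx.2 rfl
  have hτu : ∀ᶠ x in 𝓝 x₀, u x = 0 → τ x = 0 := by
    have h1 : Filter.Tendsto (fun x : E => (x, (0 : ℝ))) (𝓝 x₀) (𝓝 (x₀, 0)) :=
      Continuous.tendsto' (by fun_prop) _ _ rfl
    filter_upwards [h1.eventually hiff, hφ0] with x hx hx0 hux
    simp only [hx0] at hx
    exact (hx.1 hux).symm
  have hπd : ∀ᶠ x in 𝓝 x₀, ∀ v, fderiv ℝ (fun x => φ (τ x, x)) x v =
      fderiv ℝ τ x v • X (φ (τ x, x)) + fderiv ℝ φ (τ x, x) (0, v) := by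
    filter_upwards [hτ, htend.eventually hφ, htend.eventually hφd] with x h1 h2 h3 v
    have e1 := (h1.differentiableAt (by simp)).hasFDerivAt.prodMk (hasFDerivAt_id x)
    have e2 := (h2.differentiableAt (by simp)).hasFDerivAt.comp (f := fun x => (τ x, x)) x e1
    have e3 : fderiv ℝ (fun x => φ (τ x, x)) x = _ := e2.fderiv
    rw [e3, ← h3.1]
    have e4 : ((fderiv ℝ τ x v, v) : ℝ × E) = fderiv ℝ τ x v • ((1 : ℝ), (0 : E)) + (0, v) := by
      simp
    change fderiv ℝ φ (τ x, x) (fderiv ℝ τ x v, v) = _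
    rw [e4, map_add, map_smul]
  have huπd : ∀ᶠ x in 𝓝 x₀, ∀ v,
      fderiv ℝ u (φ (τ x, x)) (fderiv ℝ (fun x => φ (τ x, x)) x v) = 0 := by
    filter_upwards [hπ, hπtend.eventually hu, eventually_eventually_nhds.2 huπ] with x h1 h2 h3 v
    have e1 := (h2.differentiableAt (by simp)).hasFDerivAt.comp x
      (h1.differentiableAt (by simp)).hasFDerivAt
    have e2 : HasFDerivAt (u ∘ fun x => φ (τ x, x)) (0 : E →L[ℝ] ℝ) x :=
      (hasFDerivAt_const (0 : ℝ) x).congr_of_eventuallyEq h3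
    exact DFunLike.congr_fun (e1.unique e2) v
  have huXne : ∀ᶠ x in 𝓝 x₀, fderiv ℝ u x (X x) ≠ 0 :=
    (hu.fderiv.clm_apply hX).continuousAt.eventually_ne huX
  refine ⟨τ, fun x => φ (τ x, x), hτ, hπ, hτ0, hπ0, huπ, ?_, ?_, ?_⟩
  -- Invariance of `X` under the flow gives `dπ(X) = (dτ(X) + 1) X(π)`. Since `du` kills the image
  -- of `dπ` but not `X`, the coefficient vanishes.
  · filter_upwards [hπd, huπd, hπtend.eventually huXne, htend.eventually hφd] with x h1 h2 h3 h4
    have h5 := h1 (X x)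
    nth_rewrite 2 [← one_smul ℝ (X (φ (τ x, x)))] at h4
    rw [h4.2, ← add_smul] at h5
    have h6 := h2 (X x)
    rw [h5, map_smul, smul_eq_mul, mul_eq_zero, or_iff_left h3] at h6
    rw [h5, h6, zero_smul]
    exact ⟨by linarith, rfl⟩
  -- On the hypersurface `τ = 0` and `dπ(v) = dτ(v) X + v`; applying `du` to a tangent `v` forces
  -- `dτ(v) = 0`.
  · filter_upwards [hτu, hπd, huπd, huXne, htend.eventually hφ,
      eventually_eventually_nhds.2 hφ0] with x h1 h2 h3 h4 h5 h6 hux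
    have h7 := h1 hux
    have h8 : φ (0, x) = x := h6.self_of_nhds
    have h9 : ∀ v, fderiv ℝ φ (0, x) (0, v) = v := by
      intro v
      rw [h7] at h5
      have e1 := (h5.differentiableAt (by simp)).hasFDerivAt.comp x
        (hasFDerivAt_prodMk_right (𝕜 := ℝ) (0 : ℝ) x)
      have e2 : HasFDerivAt (φ ∘ fun x => ((0 : ℝ), x)) (ContinuousLinearMap.id ℝ E) x :=
        (hasFDerivAt_id x).congr_of_eventuallyEq h6
      exact DFunLike.congr_fun (e1.unique e2) v
    refine ⟨by rw [h7, h8], fun v hv => ?_⟩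
    have h10 := h2 v
    have h11 := h3 v
    rw [h7, h8, h9] at h10
    rw [h7, h8, h10, map_add, map_smul, hv, add_zero, smul_eq_mul, mul_eq_zero,
      or_iff_left h4] at h11
    refine ⟨h11, ?_⟩
    rw [h10, h11, zero_smul, zero_add]
  · intro k hk hkX
    have hφtend : Filter.Tendsto φ (𝓝 (0, x₀)) (𝓝 x₀) :=
      hφ.tendsto hφx
    obtain ⟨δ, hδ, hball⟩ := Metric.eventually_nhds_iff.1
      ((hφ.and hφd).and (hφtend.eventually (hk.and hkX)))
    filter_upwards [htend.eventually (Metric.ball_mem_nhds _ hδ), hφ0] with x hx hx0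
    rw [Prod.dist_eq, max_lt_iff, dist_zero_right, Real.norm_eq_abs] at hx
    -- `k` has zero derivative along the trajectory joining `x` to `π x`.
    have hder : ∀ s ∈ Set.Ioo (-δ) δ, HasDerivAt (fun s => k (φ (s, x))) 0 s := by
      intro s hs
      obtain ⟨⟨e1, e2, -⟩, e3, e4⟩ := hball (y := (s, x)) (by
        rw [Prod.dist_eq, max_lt_iff, dist_zero_right, Real.norm_eq_abs]
        exact ⟨abs_lt.2 hs, hx.2⟩)
      have ha : HasDerivAt (fun s : ℝ => (s, x)) ((1 : ℝ), (0 : E)) s :=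
        (hasDerivAt_id s).prodMk (hasDerivAt_const s x)
      have h1 := (e1.differentiableAt (by simp)).hasFDerivAt.comp_hasDerivAt s ha
      have h2 := (e3.differentiableAt (by simp)).hasFDerivAt.comp_hasDerivAt s h1
      rw [e2, e4] at h2
      exact h2
    have h0 : k (φ (0, x)) = k x := by rw [hx0]
    rw [← h0]
    exact isOpen_Ioo.is_const_of_deriv_eq_zero isPreconnected_Ioo
      (f := fun s => k (φ (s, x)))
      (fun s hs => (hder s hs).differentiableAt.differentiableWithinAt)
      (fun s hs => (hder s hs).deriv) (abs_lt.1 hx.1) ⟨by linarith, hδ⟩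

end FlowProjection

/-! ### Functions with prescribed derivatives along commuting fields. -/

section CommutingFields

variable {E : Type*} [NormedAddCommGroup E] [NormedSpace ℝ E]

theorem fderiv_fderiv_apply {g : E → ℝ} {X : E → E} {x : E} (hg : ContDiffAt ℝ ∞ g x)
    (hX : DifferentiableAt ℝ X x) (v : E) :
    fderiv ℝ (fun y => fderiv ℝ g y (X y)) x v =
      fderiv ℝ (fderiv ℝ g) x v (X x) + fderiv ℝ g x (fderiv ℝ X x v) := by
  have h1 : DifferentiableAt ℝ (fderiv ℝ g) x :=
    (hg.fderiv_right (m := ∞) (by simp)).differentiableAt (by simp)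
  rw [fderiv_clm_apply h1 hX]
  simp [add_comm]

theorem fderiv_fderiv_symm {g : E → ℝ} {x : E} (hg : ContDiffAt ℝ ∞ g x) (v w : E) :
    fderiv ℝ (fderiv ℝ g) x v w = fderiv ℝ (fderiv ℝ g) x w v :=
  (hg.isSymmSndFDerivAt (by
    rw [minSmoothness_of_isRCLikeNormedField]
    exact WithTop.coe_le_coe.2 le_top)).eq v w

/-- The second-derivative terms agree by symmetry; the rest differs by `dg` of the Lie bracket,
which `hXY` makes zero. -/
theorem fderiv_apply_comm_of_commute {g : E → ℝ} {X Y : E → E} {x : E} (hg : ContDiffAt ℝ ∞ g x)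
    (hX : DifferentiableAt ℝ X x) (hY : DifferentiableAt ℝ Y x)
    (hXY : fderiv ℝ X x (Y x) = fderiv ℝ Y x (X x)) :
    fderiv ℝ (fun y => fderiv ℝ g y (X y)) x (Y x) =
      fderiv ℝ (fun y => fderiv ℝ g y (Y y)) x (X x) := by
  rw [fderiv_fderiv_apply hg hX, fderiv_fderiv_apply hg hY, hXY, fderiv_fderiv_symm hg]

variable [FiniteDimensional ℝ E]

/-- Given commuting, linearly independent vector fields, there is a function whose derivatives
along these fields are prescribed constants, with any compatible differential at the base point. -/
theorem exists_smooth_of_commuting_fields {x₀ : E} :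
    ∀ {r : ℕ} (X : Fin r → E → E), (∀ i, SmoothNear (X i) x₀) →
      (∀ i j, ∀ᶠ x in 𝓝 x₀, fderiv ℝ (X i) x (X j x) = fderiv ℝ (X j) x (X i x)) →
      LinearIndependent ℝ (fun i => X i x₀) → ∀ (c : Fin r → ℝ) (ℓ : E →L[ℝ] ℝ),
      (∀ i, ℓ (X i x₀) = c i) →
      ∃ g : E → ℝ, SmoothNear g x₀ ∧ g x₀ = 0 ∧ fderiv ℝ g x₀ = ℓ ∧
        ∀ i, ∀ᶠ x in 𝓝 x₀, fderiv ℝ g x (X i x) = c i := by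
  intro r
  induction r with
  | zero =>
    intro X _ _ _ c ℓ _
    refine ⟨fun x => ℓ x - ℓ x₀, ContDiff.smoothNear (ℓ.contDiff.sub contDiff_const) _, sub_self _,
      ?_, fun i => i.elim0⟩
    exact (ℓ.hasFDerivAt.sub_const _).fderiv
  | succ r ih =>
    intro X hX hcomm hli c ℓ hℓ
    have hX' : ∀ i : Fin r, SmoothNear (X i.castSucc) x₀ := fun i => hX _
    have hli' : LinearIndependent ℝ (fun i : Fin r => X i.castSucc x₀) :=
      hli.comp _ (Fin.castSucc_injective r)
    obtain ⟨g₀, hg₀, hg₀0, hg₀d, hg₀X⟩ := ih (fun i => X i.castSucc) hX' (fun i j => hcomm _ _)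
      hli' (fun i => c i.castSucc) ℓ (fun i => hℓ _)
    have hnot : X (Fin.last r) x₀ ∉ Submodule.span ℝ (Set.range fun i : Fin r => X i.castSucc x₀) := by
      have h := hli.notMem_span_image (s := Set.range Fin.castSucc) (x := Fin.last r)
        (by rintro ⟨i, hi⟩; exact (Fin.castSucc_lt_last i).ne hi)
      rwa [← Set.range_comp] at h
    obtain ⟨ℓ₁, hℓ₁, hle⟩ := Submodule.exists_le_ker_of_notMem hnot
    have hℓ₁' : ∀ i : Fin r, ℓ₁ (X i.castSucc x₀) = 0 := fun i =>
      hle (Submodule.subset_span ⟨i, rfl⟩)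
    -- The hypersurface `u = 0` is tangent to the earlier fields and, since `ℓ₁` does not kill the
    -- last one, transverse to it.
    obtain ⟨u, hu, hu0, hud, huX⟩ := ih (fun i => X i.castSucc) hX' (fun i j => hcomm _ _)
      hli' (fun _ => 0) (LinearMap.toContinuousLinearMap ℓ₁) hℓ₁'
    have huX₁ : fderiv ℝ u x₀ (X (Fin.last r) x₀) ≠ 0 := by
      rw [hud]
      exact hℓ₁
    obtain ⟨τ, π, hτ, hπ, hτ0, hπ0, huπ, hdX, htan, hinv⟩ :=
      exists_flow_projection (hX (Fin.last r)) hu hu0 huX₁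
    set c' := c (Fin.last r)
    set Y := X (Fin.last r)
    -- Keep `g₀` on the hypersurface and extend with slope `c'` along `Y`; the minus sign
    -- compensates `dτ(Y) = -1`.
    set g : E → ℝ := fun x => g₀ (π x) - c' * τ x
    have hg : SmoothNear g x₀ := by
      filter_upwards [SmoothNear.comp' (g := g₀) hg₀ hπ hπ0, hτ] with x h1 h2
      exact h1.sub (contDiffAt_const.mul h2)
    have hgd : ∀ᶠ x in 𝓝 x₀, ∀ v, fderiv ℝ g x v =
        fderiv ℝ g₀ (π x) (fderiv ℝ π x v) - c' * fderiv ℝ τ x v := by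
      filter_upwards [(hπ.tendsto hπ0).eventually hg₀, hπ, hτ] with x h1 h2 h3 v
      have e1 := (h1.differentiableAt (by simp)).hasFDerivAt.comp x
        (h2.differentiableAt (by simp)).hasFDerivAt
      have e2 := e1.sub ((h3.differentiableAt (by simp)).hasFDerivAt.const_mul c')
      exact DFunLike.congr_fun e2.fderiv v
    have hgY : ∀ᶠ x in 𝓝 x₀, fderiv ℝ g x (Y x) = c' := by
      filter_upwards [hgd, hdX] with x h1 h2
      rw [h1, h2.1, h2.2, map_zero]
      ring
    have hgu : ∀ᶠ x in 𝓝 x₀, u x = 0 → ∀ v, fderiv ℝ u x v = 0 →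
        fderiv ℝ g x v = fderiv ℝ g₀ x v := by
      filter_upwards [hgd, htan] with x h1 h2 hux v hv
      obtain ⟨h3, h4⟩ := h2 hux
      rw [h1, (h4 v hv).1, (h4 v hv).2, h3]
      ring
    refine ⟨g, hg, ?_, ?_, ?_⟩
    · simp only [g, hπ0, hτ0, hg₀0]
      ring
    · ext v
      -- `dg` and `ℓ` agree on the kernel of `du` and on `Y x₀`, which together span `E`.
      set a := fderiv ℝ u x₀ v / fderiv ℝ u x₀ (Y x₀)
      have hv : fderiv ℝ u x₀ (v - a • Y x₀) = 0 := by
        rw [map_sub, map_smul, smul_eq_mul, div_mul_cancel₀ _ huX₁, sub_self]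
      have h1 := hgu.self_of_nhds hu0 _ hv
      rw [map_sub, map_sub, map_smul, map_smul, hgY.self_of_nhds, hg₀d, hℓ] at h1
      exact sub_left_injective h1
    · intro i
      refine Fin.lastCases hgY (fun i => ?_) i
      set Z := X i.castSucc
      -- `Z g` is constant along `Y`, because the fields commute and `Y g` is constant. On `u = 0`
      -- it equals `Z g₀`, the prescribed constant, as `Z` is tangent there; invariance carries this
      -- value to nearby points.
      have hk : SmoothNear (fun x => fderiv ℝ g x (Z x)) x₀ := hg.fderiv.clm_apply (hX' i)
      have hkY : ∀ᶠ x in 𝓝 x₀, fderiv ℝ (fun x => fderiv ℝ g x (Z x)) x (Y x) = 0 := by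
        filter_upwards [hg, hX' i, hX (Fin.last r), hcomm i.castSucc (Fin.last r),
          eventually_eventually_nhds.2 hgY] with x h1 h2 h3 h4 h5
        rw [fderiv_apply_comm_of_commute h1 (h2.differentiableAt (by simp))
          (h3.differentiableAt (by simp)) h4]
        have h6 : HasFDerivAt (fun y => fderiv ℝ g y (Y y)) (0 : E →L[ℝ] ℝ) x :=
          (hasFDerivAt_const c' x).congr_of_eventuallyEq h5
        rw [h6.fderiv]
        rfl
      have hku : ∀ᶠ x in 𝓝 x₀, u x = 0 → fderiv ℝ g x (Z x) = c i.castSucc := by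
        filter_upwards [hgu, huX i, hg₀X i] with x h1 h2 h3 hux
        rw [h1 hux _ h2, h3]
      filter_upwards [hinv _ hk hkY, (hπ.tendsto hπ0).eventually hku, huπ] with x h1 h2 h3
      rw [← h1, h2 h3]

end CommutingFields

/-! ### Darboux coordinates containing a given Hamiltonian. -/

section LocalDarboux

variable {E : Type*} [NormedAddCommGroup E] [NormedSpace ℝ E]

/-- The Hamiltonian vector field of `f` with respect to a field `b` of bilinear forms on a vector
space. -/
noncomputable def localHamiltonianField (b : E → E →L[ℝ] E →L[ℝ] ℝ) (f : E → ℝ) (x : E) : E :=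
  (b x).inverse (fderiv ℝ f x)

/-- A field of bilinear forms on a vector space which is a symplectic form near `x₀`. -/
structure IsSymplecticNear (b : E → E →L[ℝ] E →L[ℝ] ℝ) (x₀ : E) : Prop where
  smooth : SmoothNear b x₀
  alternating : ∀ᶠ x in 𝓝 x₀, ∀ v, b x v v = 0
  closed : ∀ᶠ x in 𝓝 x₀, ∀ u v w,
    fderiv ℝ b x u v w - fderiv ℝ b x v u w + fderiv ℝ b x w u v = 0
  isInvertible : (b x₀).IsInvertible

variable {b : E → E →L[ℝ] E →L[ℝ] ℝ} {x₀ : E}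

theorem IsSymplecticNear.antisymm (hb : IsSymplecticNear b x₀) :
    ∀ᶠ x in 𝓝 x₀, ∀ v w, b x v w = -b x w v := by
  filter_upwards [hb.alternating] with x hx v w
  have h := hx (v + w)
  simp only [map_add, add_apply, hx, zero_add, add_zero] at h
  linarith

theorem IsSymplecticNear.fderiv_antisymm (hb : IsSymplecticNear b x₀) :
    ∀ᶠ x in 𝓝 x₀, ∀ u v w, fderiv ℝ b x u v w = -fderiv ℝ b x u w v := by
  filter_upwards [hb.smooth, eventually_eventually_nhds.2 hb.antisymm] with x h1 h2 u v w
  have hd := (h1.differentiableAt (by simp)).hasFDerivAt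
  have e : ∀ v w, HasFDerivAt (fun y => b y v w)
      (((fderiv ℝ b x).flip v).flip w) x := fun v w => by
    have h3 := (hd.clm_apply (hasFDerivAt_const v x)).clm_apply (hasFDerivAt_const w x)
    refine h3.congr_fderiv ?_
    ext u
    simp
  have h4 : HasFDerivAt (fun y => b y v w) (-((fderiv ℝ b x).flip w).flip v) x :=
    (e w v).neg.congr_of_eventuallyEq (h2.mono fun y hy => hy v w)
  exact DFunLike.congr_fun ((e v w).unique h4) u

theorem IsSymplecticNear.eventually_isInvertible [CompleteSpace E] (hb : IsSymplecticNear b x₀) :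
    ∀ᶠ x in 𝓝 x₀, (b x).IsInvertible := by
  obtain ⟨e, he⟩ := hb.isInvertible
  have := hb.smooth.tendsto he.symm
  filter_upwards [this.eventually e.nhds] with x hx using hx

theorem IsSymplecticNear.apply_localHamiltonianField [CompleteSpace E]
    (hb : IsSymplecticNear b x₀) :
    ∀ᶠ x in 𝓝 x₀, ∀ f : E → ℝ, b x (localHamiltonianField b f x) = fderiv ℝ f x := by
  filter_upwards [hb.eventually_isInvertible] with x hx f
  obtain ⟨e, he⟩ := hx
  rw [localHamiltonianField, ← he, ContinuousLinearMap.inverse_equiv]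
  exact e.apply_symm_apply _

theorem IsSymplecticNear.smoothNear_localHamiltonianField [CompleteSpace E]
    (hb : IsSymplecticNear b x₀) {f : E → ℝ} (hf : SmoothNear f x₀) :
    SmoothNear (localHamiltonianField b f) x₀ := by
  refine SmoothNear.clm_apply ?_ hf.fderiv
  filter_upwards [hb.smooth, hb.eventually_isInvertible] with x h1 h2
  exact ContDiffAt.comp (g := ContinuousLinearMap.inverse) x h2.contDiffAt_map_inverse h1

/-- The Hamiltonian vector fields of functions with constant Poisson bracket commute. -/
theorem IsSymplecticNear.commute_of_bracket_const [CompleteSpace E] (hb : IsSymplecticNear b x₀)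
    {f g : E → ℝ} (hf : SmoothNear f x₀) (hg : SmoothNear g x₀) {c : ℝ}
    (hc : ∀ᶠ x in 𝓝 x₀,
      b x (localHamiltonianField b f x) (localHamiltonianField b g x) = c) :
    ∀ᶠ x in 𝓝 x₀, fderiv ℝ (localHamiltonianField b f) x (localHamiltonianField b g x) =
      fderiv ℝ (localHamiltonianField b g) x (localHamiltonianField b f x) := by
  have key : ∀ {f : E → ℝ}, SmoothNear f x₀ → ∀ᶠ x in 𝓝 x₀, ∀ v w,
      fderiv ℝ b x v (localHamiltonianField b f x) w +
        b x (fderiv ℝ (localHamiltonianField b f) x v) w = fderiv ℝ (fderiv ℝ f) x v w := by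
    intro f hf
    filter_upwards [hb.smooth, hb.smoothNear_localHamiltonianField hf,
      eventually_eventually_nhds.2 hb.apply_localHamiltonianField] with x h1 h2 h3 v w
    have h4 : (fun y => b y (localHamiltonianField b f y)) =ᶠ[𝓝 x] fderiv ℝ f :=
      h3.mono fun y hy => hy f
    rw [← h4.fderiv_eq, fderiv_clm_apply (h1.differentiableAt (by simp))
      (h2.differentiableAt (by simp))]
    simp [add_comm]
  filter_upwards [hb.smooth, hf, hg, hb.smoothNear_localHamiltonianField hf,
    hb.smoothNear_localHamiltonianField hg, hb.antisymm, hb.fderiv_antisymm, hb.closed,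
    key hf, key hg, hb.apply_localHamiltonianField, hb.eventually_isInvertible,
    eventually_eventually_nhds.2 (hb.apply_localHamiltonianField.and hc)]
    with x h1 h2 h3 h4 h5 h6 h7 h8 h9 h10 h11 h12 h13
  set X := localHamiltonianField b f
  set Y := localHamiltonianField b g
  -- Derivative in direction `z` of the constant bracket `df(Y)`.
  have hz : ∀ z, fderiv ℝ (fderiv ℝ f) x z (Y x) + b x (X x) (fderiv ℝ Y x z) = 0 := by
    intro z
    rw [h11, ← fderiv_fderiv_apply h2 (h5.differentiableAt (by simp))]
    have h14 : HasFDerivAt (fun y => fderiv ℝ f y (Y y)) (0 : E →L[ℝ] ℝ) x :=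
      (hasFDerivAt_const c x).congr_of_eventuallyEq
        (h13.mono fun y hy => by
          change fderiv ℝ f y (Y y) = c
          rw [← hy.1 f]
          exact hy.2)
    rw [h14.fderiv]
    rfl
  obtain ⟨e, he⟩ := h12
  have hinj : Function.Injective (b x) := he ▸ e.injective
  apply hinj
  ext z
  -- The identity expressing the contraction of the form with `[X, Y]` as, up to sign, the
  -- differential of the bracket, tested on `z`; closedness enters as `a7`.
  have a1 := h9 (Y x) z
  have a2 := h10 (X x) z
  have a3 := hz z
  have a4 := h6 (X x) (fderiv ℝ Y x z)
  have a5 := h10 z (X x)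
  have a6 := h7 z (X x) (Y x)
  have a7 := h8 (X x) (Y x) z
  have a8 := fderiv_fderiv_symm h2 z (Y x)
  have a9 := fderiv_fderiv_symm h3 z (X x)
  linarith

variable [FiniteDimensional ℝ E]

/-- Any function with nonzero differential is the first of a maximal family of functions with
constant Poisson brackets and independent Hamiltonian vector fields. -/
theorem IsSymplecticNear.exists_constant_brackets (hb : IsSymplecticNear b x₀) {H : E → ℝ}
    (hH : SmoothNear H x₀) (hdH : fderiv ℝ H x₀ ≠ 0) (r : ℕ) :
    r < Module.finrank ℝ E → ∃ f : Fin (r + 1) → E → ℝ, f 0 = H ∧ (∀ i, SmoothNear (f i) x₀) ∧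
      LinearIndependent ℝ (fun i => localHamiltonianField b (f i) x₀) ∧
      ∀ i j, ∃ c : ℝ, ∀ᶠ x in 𝓝 x₀,
        b x (localHamiltonianField b (f i) x) (localHamiltonianField b (f j) x) = c := by
  induction r with
  | zero =>
    intro _
    refine ⟨fun _ => H, rfl, fun _ => hH, ?_, fun _ _ => ⟨0, ?_⟩⟩
    · have : Subsingleton (Fin (0 + 1)) := inferInstanceAs (Subsingleton (Fin 1))
      refine LinearIndependent.of_subsingleton 0 fun h => hdH ?_
      rw [← hb.apply_localHamiltonianField.self_of_nhds H, h, map_zero]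
    · filter_upwards [hb.alternating] with x hx
      exact hx _
  | succ r ih =>
    intro hr
    obtain ⟨f, hf0, hf, hli, hc⟩ := ih (by omega)
    obtain ⟨v, hv⟩ := exists_linearIndependent_snoc_of_lt_finrank hli hr
    choose c hc using hc
    -- The differential `b x₀ v` gives the new Hamiltonian field the value `v` at `x₀`. The
    -- derivatives of `g` along the old fields are its brackets with the old functions, so they are
    -- prescribed as constants.
    obtain ⟨g, hg, -, hgd, hgX⟩ := exists_smooth_of_commuting_fields
      (fun i => localHamiltonianField b (f i))
      (fun i => hb.smoothNear_localHamiltonianField (hf i))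
      (fun i j => hb.commute_of_bracket_const (hf i) (hf j) (hc i j)) hli
      (fun i => b x₀ v (localHamiltonianField b (f i) x₀)) (b x₀ v) (fun _ => rfl)
    have hXg : localHamiltonianField b g x₀ = v := by
      rw [localHamiltonianField, hgd]
      obtain ⟨e, he⟩ := hb.isInvertible
      rw [← he, ContinuousLinearMap.inverse_equiv]
      exact e.symm_apply_apply v
    have hgf : ∀ i, ∃ c : ℝ, ∀ᶠ x in 𝓝 x₀,
        b x (localHamiltonianField b g x) (localHamiltonianField b (f i) x) = c := fun i => by
      refine ⟨b x₀ v (localHamiltonianField b (f i) x₀), ?_⟩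
      filter_upwards [hgX i, hb.apply_localHamiltonianField] with x h1 h2
      rw [h2, h1]
    refine ⟨Fin.snoc f g, ?_, fun i => ?_, ?_, fun i j => ?_⟩
    · rw [← hf0]
      exact Fin.snoc_castSucc (α := fun _ => E → ℝ) g f 0
    · refine Fin.lastCases ?_ (fun i => ?_) i
      · simpa using hg
      · simpa using hf i
    · convert! hv using 1
      funext i
      refine Fin.lastCases ?_ (fun i => ?_) i
      · simpa using hXg
      · simp
    · induction i using Fin.lastCases with
      | last =>
        induction j using Fin.lastCases with
        | last =>
          refine ⟨0, ?_⟩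
          filter_upwards [hb.alternating] with x hx
          exact hx _
        | cast j => simpa using hgf j
      | cast i =>
        induction j using Fin.lastCases with
        | last =>
          obtain ⟨c, hc⟩ := hgf i
          refine ⟨-c, ?_⟩
          filter_upwards [hc, hb.antisymm] with x h1 h2
          simp only [Fin.snoc_castSucc, Fin.snoc_last]
          rw [h2, h1]
        | cast j => simpa using ⟨_, hc i j⟩

/-- Darboux's theorem, with a Hamiltonian vector field made constant as well. -/
theorem IsSymplecticNear.exists_darboux_chart (hb : IsSymplecticNear b x₀) {H : E → ℝ}
    (hH : SmoothNear H x₀) (hdH : fderiv ℝ H x₀ ≠ 0) {s : Set E} (hs : s ∈ 𝓝 x₀) :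
    ∃ Φ : OpenPartialHomeomorph E E, x₀ ∈ Φ.source ∧ Φ.source ⊆ s ∧
      (∀ x ∈ Φ.source, ContDiffAt ℝ ∞ Φ x) ∧ (∀ y ∈ Φ.target, ContDiffAt ℝ ∞ Φ.symm y) ∧
      (∀ x ∈ Φ.source, ∀ v w, b x v w = b x₀ (fderiv ℝ Φ x v) (fderiv ℝ Φ x w)) ∧
      ∃ c : E, ∀ x ∈ Φ.source, ∀ v, fderiv ℝ H x v = b x₀ c (fderiv ℝ Φ x v) := by
  have hnt : 0 < Module.finrank ℝ E := by
    rw [Module.finrank_pos_iff]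
    by_contra h
    rw [not_nontrivial_iff_subsingleton] at h
    exact hdH (Subsingleton.elim _ _)
  obtain ⟨r, hr⟩ : ∃ r, Module.finrank ℝ E = r + 1 := ⟨_, (Nat.succ_pred_eq_of_pos hnt).symm⟩
  obtain ⟨f, hf0, hf, hli, hc⟩ := hb.exists_constant_brackets hH hdH r (by omega)
  let β := basisOfLinearIndependentOfCardEqFinrank hli (by simp [hr])
  have hβ : ∀ i, β i = localHamiltonianField b (f i) x₀ := fun i => by
    simp [β]
  obtain ⟨e, he⟩ := hb.isInvertible
  let A₀ : E →L[ℝ] (Fin (r + 1) → ℝ) := ContinuousLinearMap.pi fun i => b x₀ (β i)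
  have hA₀ : Function.Injective A₀ := by
    rw [injective_iff_map_eq_zero]
    intro v hv
    have h1 : (b x₀).flip v = 0 := by
      refine ContinuousLinearMap.coe_injective (β.ext fun i => ?_)
      exact congrFun hv i
    have h2 : b x₀ v = 0 := by
      ext w
      rw [hb.antisymm.self_of_nhds]
      simpa using DFunLike.congr_fun h1 w
    rw [← he] at h2
    exact e.injective (h2.trans (map_zero e).symm)
  let A : E ≃L[ℝ] (Fin (r + 1) → ℝ) :=
    (LinearEquiv.ofInjectiveOfFinrankEq A₀.toLinearMap hA₀ (by simp [hr])).toContinuousLinearEquiv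
  have hA : ∀ v i, A v i = b x₀ (β i) v := fun v i => rfl
  -- Composing with `A.symm` normalises the derivative of `Ψ` at `x₀` to the identity.
  let Ψ : E → E := fun x => A.symm fun i => f i x
  have hdΨ : ∀ x, (∀ i, ContDiffAt ℝ ∞ (f i) x) → HasFDerivAt Ψ
      ((A.symm : (Fin (r + 1) → ℝ) →L[ℝ] E).comp
        (ContinuousLinearMap.pi fun i => fderiv ℝ (f i) x)) x := fun x hx =>
    (A.symm : (Fin (r + 1) → ℝ) →L[ℝ] E).hasFDerivAt.comp x
      (hasFDerivAt_pi.2 fun i => ((hx i).differentiableAt (by simp)).hasFDerivAt)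
  have hfall : ∀ᶠ x in 𝓝 x₀, ∀ i, ContDiffAt ℝ ∞ (f i) x := Filter.eventually_all.2 hf
  have hΨ : SmoothNear Ψ x₀ := by
    filter_upwards [hfall] with x hx
    exact (A.symm : (Fin (r + 1) → ℝ) →L[ℝ] E).contDiff.contDiffAt.comp x (contDiffAt_pi.2 hx)
  -- The components of the image of the `j`-th field are, through `A`, the brackets with the `f i`;
  -- being constant, they keep their values at `x₀`.
  have hX : ∀ᶠ x in 𝓝 x₀, ∀ j, fderiv ℝ Ψ x (localHamiltonianField b (f j) x) = β j := by
    choose c hc using hc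
    have hc' : ∀ᶠ x in 𝓝 x₀, ∀ i j,
        b x (localHamiltonianField b (f i) x) (localHamiltonianField b (f j) x) = c i j :=
      Filter.eventually_all.2 fun i => Filter.eventually_all.2 fun j => hc i j
    filter_upwards [hfall, hc', hb.apply_localHamiltonianField] with x h1 h2 h3 j
    rw [(hdΨ x h1).fderiv]
    refine A.symm_apply_eq.2 (funext fun i => ?_)
    change fderiv ℝ (f i) x _ = _
    rw [hA, hβ, hβ, hc'.self_of_nhds, ← h2 i j, h3]
  have hid : fderiv ℝ Ψ x₀ = ContinuousLinearMap.id ℝ E := by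
    refine ContinuousLinearMap.coe_injective (β.ext fun j => ?_)
    have := hX.self_of_nhds j
    rw [← hβ] at this
    exact this
  have hinv : ∀ᶠ x in 𝓝 x₀, (fderiv ℝ Ψ x).IsInvertible := by
    have h1 := hΨ.fderiv.tendsto hid
    exact h1.eventually (ContinuousLinearEquiv.refl ℝ E).nhds
  have hbr : ∀ᶠ x in 𝓝 x₀, ∀ i j,
      b x (localHamiltonianField b (f i) x) (localHamiltonianField b (f j) x) =
        b x₀ (β i) (β j) := by
    refine Filter.eventually_all.2 fun i => Filter.eventually_all.2 fun j => ?_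
    obtain ⟨c, hc⟩ := hc i j
    filter_upwards [hc] with x hx
    rw [hx, hβ, hβ, hc.self_of_nhds]
  -- The form is determined by the brackets on the frame of Hamiltonian fields, which `Ψ` sends to
  -- the fixed basis `β`.
  have hform : ∀ᶠ x in 𝓝 x₀, ∀ v w, b x v w = b x₀ (fderiv ℝ Ψ x v) (fderiv ℝ Ψ x w) := by
    filter_upwards [hX, hinv, hbr] with x h1 h2 h3 v w
    obtain ⟨L, hL⟩ := h2
    rw [← hL] at h1 ⊢
    have h4 : ∀ j, L.symm (β j) = localHamiltonianField b (f j) x := fun j => by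
      rw [L.symm_apply_eq]
      exact (h1 j).symm
    have h5 : ((b x).bilinearComp (L.symm : E →L[ℝ] E) (L.symm : E →L[ℝ] E)) = b x₀ := by
      refine ContinuousLinearMap.coe_injective (β.ext fun i => ?_)
      refine ContinuousLinearMap.coe_injective (β.ext fun j => ?_)
      change b x (L.symm (β i)) (L.symm (β j)) = _
      rw [h4, h4, h3]
      rfl
    have h6 := DFunLike.congr_fun (DFunLike.congr_fun h5 (L v)) (L w)
    simpa using h6
  obtain ⟨Φ, hΦ, hmem, hsub, hsm, hsm'⟩ := hΨ.exists_openPartialHomeomorph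
    (ContinuousLinearEquiv.refl ℝ E) (by
      have := hΨ.differentiableAt.hasFDerivAt
      rw [hid] at this
      exact this)
    (Filter.inter_mem hs (Filter.inter_mem (Filter.inter_mem hform hX)
      hb.apply_localHamiltonianField))
  refine ⟨Φ, hmem, fun x hx => (hsub hx).1, hsm, hsm', fun x hx => ?_, β 0, fun x hx v => ?_⟩
  · rw [hΦ]
    exact (hsub hx).2.1.1
  · obtain ⟨-, ⟨h1, h2⟩, h3⟩ := hsub hx
    have e1 : b x (localHamiltonianField b H x) = fderiv ℝ H x := h3 H
    have e2 : ∀ v w, b x v w = b x₀ (fderiv ℝ Ψ x v) (fderiv ℝ Ψ x w) := h1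
    have e3 : fderiv ℝ Ψ x (localHamiltonianField b (f 0) x) = β 0 := h2 0
    rw [hf0] at e3
    rw [hΦ, ← e1, e2, e3]

end LocalDarboux

/-! ### Isotropic complements of coisotropic subspaces. -/

section SymplecticLinearAlgebra

variable {V : Type*} [AddCommGroup V] [Module ℝ V] [FiniteDimensional ℝ V]

/-- A coisotropic subspace has an isotropic complement through any vector outside of it. -/
theorem exists_isotropic_isCompl (B : LinearMap.BilinForm ℝ V) (hB : B.IsAlt)
    (hnd : B.Nondegenerate) {W : Submodule ℝ V} (hW : B.orthogonal W ≤ W) {x : V} (hx : x ∉ W) :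
    ∃ D : Submodule ℝ V, x ∈ D ∧ IsCompl W D ∧ D ≤ B.orthogonal D := by
  have hrefl : B.IsRefl := hB.isRefl
  let S : Set (Submodule ℝ V) := {D | x ∈ D ∧ Disjoint W D ∧ D ≤ B.orthogonal D}
  have hS : S.Nonempty := by
    refine ⟨ℝ ∙ x, Submodule.mem_span_singleton_self x, ?_, ?_⟩
    · rw [Submodule.disjoint_span_singleton]
      exact fun h => absurd h hx
    · intro v hv w hw
      obtain ⟨a, rfl⟩ := Submodule.mem_span_singleton.1 hv
      obtain ⟨c, rfl⟩ := Submodule.mem_span_singleton.1 hw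
      simp [hB x]
  obtain ⟨D, ⟨hxD, hWD, hD⟩, hmax⟩ :=
    WellFounded.has_min (wellFounded_gt : WellFounded ((· > ·) : Submodule ℝ V → _ → Prop)) S hS
  refine ⟨D, hxD, ⟨hWD, ?_⟩, hD⟩
  rw [codisjoint_iff]
  -- A vector of `D^⊥` outside `W ⊔ D` could be added to `D`, contradicting maximality.
  have hle : B.orthogonal D ≤ W ⊔ D := by
    by_contra h
    obtain ⟨y, hyD, hy⟩ := SetLike.not_le_iff_exists.1 h
    refine hmax (D ⊔ ℝ ∙ y) ⟨Submodule.mem_sup_left hxD, ?_, ?_⟩ ?_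
    · rw [Submodule.disjoint_def]
      intro w hw hw'
      obtain ⟨d, hd, z, hz, rfl⟩ := Submodule.mem_sup.1 hw'
      obtain ⟨a, rfl⟩ := Submodule.mem_span_singleton.1 hz
      by_cases ha : a = 0
      · subst ha
        rw [zero_smul, add_zero] at hw ⊢
        exact Submodule.disjoint_def.1 hWD d hw hd
      · refine absurd ?_ hy
        have h1 : a • y ∈ W ⊔ D := by
          have : a • y = (d + a • y) - d := by abel
          rw [this]
          exact Submodule.sub_mem _ (Submodule.mem_sup_left hw) (Submodule.mem_sup_right hd)
        exact (Submodule.smul_mem_iff _ ha).1 h1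
    · intro v hv w hw
      obtain ⟨d, hd, z, hz, rfl⟩ := Submodule.mem_sup.1 hv
      obtain ⟨a, rfl⟩ := Submodule.mem_span_singleton.1 hz
      obtain ⟨d', hd', z', hz', rfl⟩ := Submodule.mem_sup.1 hw
      obtain ⟨a', rfl⟩ := Submodule.mem_span_singleton.1 hz'
      have e1 : B d' d = 0 := hD hd d' hd'
      have e2 : B d' y = 0 := hyD d' hd'
      have e3 : B y d = 0 := hrefl _ _ (hyD d hd)
      simp [e1, e2, e3, hB y]
    · refine lt_of_le_of_ne le_sup_left fun h => hy ?_
      refine Submodule.mem_sup_right ?_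
      rw [h]
      exact Submodule.mem_sup_right (Submodule.mem_span_singleton_self y)
  -- A vector orthogonal to `W ⊔ D` is orthogonal to `D^⊥`, hence in `D`, and lies in `W` by
  -- coisotropy; so it is zero.
  have hbot : B.orthogonal (W ⊔ D) = ⊥ := by
    rw [eq_bot_iff]
    intro z hz
    have h1 : z ∈ D := by
      rw [← LinearMap.BilinForm.orthogonal_orthogonal hnd hrefl D]
      exact fun y hy => hz y (hle hy)
    have h2 : z ∈ W := hW fun y hy => hz y (Submodule.mem_sup_left hy)
    exact Submodule.disjoint_def.1 hWD z h2 h1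
  rw [← LinearMap.BilinForm.orthogonal_orthogonal hnd hrefl (W ⊔ D), hbot]
  exact LinearMap.BilinForm.orthogonal_bot

/-- A subspace is the kernel of a linear surjection onto a space of complementary dimension. -/
theorem exists_surjective_ker_eq {V' : Type*} [AddCommGroup V'] [Module ℝ V']
    [FiniteDimensional ℝ V'] (W : Submodule ℝ V)
    (h : Module.finrank ℝ W + Module.finrank ℝ V' = Module.finrank ℝ V) :
    ∃ A : V →ₗ[ℝ] V', Function.Surjective A ∧ LinearMap.ker A = W := by
  have hq : Module.finrank ℝ (V ⧸ W) = Module.finrank ℝ V' := by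
    have := W.finrank_quotient_add_finrank
    omega
  let e := LinearEquiv.ofFinrankEq (V ⧸ W) V' hq
  refine ⟨e.toLinearMap ∘ₗ W.mkQ, e.surjective.comp W.mkQ_surjective, ?_⟩
  rw [LinearMap.ker_comp, LinearEquiv.ker, Submodule.comap_bot, Submodule.ker_mkQ]

end SymplecticLinearAlgebra

/-! ### Alternating 2-forms as bilinear forms. -/

section BilinearForms

variable {E : Type*} [NormedAddCommGroup E] [NormedSpace ℝ E]

/-- An alternating 2-form as a bilinear form. -/
noncomputable def alternatingToBilin (η : E [⋀^Fin 2]→L[ℝ] ℝ) : E →L[ℝ] E →L[ℝ] ℝ :=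
  LinearMap.mkContinuous₂ (LinearMap.mk₂ ℝ (fun v w => η ![v, w])
    (fun v v' w => DFunLike.congr_fun (η.curryLeft.map_add v v') ![w])
    (fun c v w => DFunLike.congr_fun (η.curryLeft.map_smul c v) ![w])
    (fun v w w' => DFunLike.congr_fun ((η.curryLeft v).curryLeft.map_add w w') ![])
    (fun c v w => DFunLike.congr_fun ((η.curryLeft v).curryLeft.map_smul c w) ![])) ‖η‖
    (fun v w => by
      refine (η.le_opNorm _).trans_eq ?_
      rw [Fin.prod_univ_two, ← mul_assoc]
      rfl)

@[simp]
theorem alternatingToBilin_apply (η : E [⋀^Fin 2]→L[ℝ] ℝ) (v w : E) :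
    alternatingToBilin η v w = η ![v, w] := rfl

theorem contDiff_alternatingToBilin :
    ContDiff ℝ ∞ (alternatingToBilin : (E [⋀^Fin 2]→L[ℝ] ℝ) → E →L[ℝ] E →L[ℝ] ℝ) :=
  IsBoundedLinearMap.contDiff
    { map_add := fun η η' => by ext v w; simp
      map_smul := fun c η => by ext v w; simp
      bound := ⟨1, one_pos, fun η => by
        rw [one_mul]
        exact LinearMap.mkContinuous₂_norm_le _ (norm_nonneg _) _⟩ }

theorem fderiv_alternatingToBilin {η : E → E [⋀^Fin 2]→L[ℝ] ℝ} {x : E}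
    (hη : DifferentiableAt ℝ η x) (u v w : E) :
    fderiv ℝ (fun y => alternatingToBilin (η y)) x u v w =
      fderiv ℝ (fun y => η y ![v, w]) x u := by
  have h1 : DifferentiableAt ℝ (fun y => alternatingToBilin (η y)) x :=
    (contDiff_alternatingToBilin.differentiable (by simp)).differentiableAt.comp x hη
  have h2 := (h1.hasFDerivAt.clm_apply (hasFDerivAt_const v x)).clm_apply (hasFDerivAt_const w x)
  simp only [alternatingToBilin_apply] at h2
  rw [h2.fderiv]
  simp

theorem alternatingToBilin_closed {η : E → E [⋀^Fin 2]→L[ℝ] ℝ} {x : E}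
    (hη : DifferentiableAt ℝ η x) (hd : extDeriv η x = 0) (u v w : E) :
    fderiv ℝ (fun y => alternatingToBilin (η y)) x u v w -
      fderiv ℝ (fun y => alternatingToBilin (η y)) x v u w +
      fderiv ℝ (fun y => alternatingToBilin (η y)) x w u v = 0 := by
  have h := extDeriv_apply hη ![u, v, w]
  rw [hd, Fin.sum_univ_three] at h
  have e0 : (0 : Fin 3).removeNth ![u, v, w] = ![v, w] := by ext i; fin_cases i <;> rfl
  have e1 : (1 : Fin 3).removeNth ![u, v, w] = ![u, w] := by ext i; fin_cases i <;> rfl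
  have e2 : (2 : Fin 3).removeNth ![u, v, w] = ![u, v] := by ext i; fin_cases i <;> rfl
  rw [e0, e1, e2] at h
  simp only [fderiv_alternatingToBilin hη]
  simp at h
  linarith

end BilinearForms

/-! ### Passage between the manifold and its charts. -/

section Charts

variable {E : Type*} [NormedAddCommGroup E] [NormedSpace ℝ E]
  {M : Type*} [TopologicalSpace M] [ChartedSpace E M]
  {e : OpenPartialHomeomorph M E}

theorem mdifferentiable_of_mem_maximalAtlas (he : e ∈ IsManifold.maximalAtlas 𝓘(ℝ, E) ∞ M) :
    e.MDifferentiable 𝓘(ℝ, E) 𝓘(ℝ, E) :=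
  ⟨(contMDiffOn_of_mem_maximalAtlas he).mdifferentiableOn (by simp),
    (contMDiffOn_symm_of_mem_maximalAtlas he).mdifferentiableOn (by simp)⟩

/-- The differential at `p` of a map to the model space, with values in the model space. -/
noncomputable def chartDiff (f : M → E) (p : M) : TangentSpace 𝓘(ℝ, E) p →L[ℝ] E :=
  mfderiv 𝓘(ℝ, E) 𝓘(ℝ, E) f p

/-- The differential of a chart as an isomorphism onto the model space. -/
noncomputable def chartDiffEquiv (he : e ∈ IsManifold.maximalAtlas 𝓘(ℝ, E) ∞ M) {p : M}
    (hp : p ∈ e.source) : TangentSpace 𝓘(ℝ, E) p ≃L[ℝ] E :=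
  (mdifferentiable_of_mem_maximalAtlas he).mfderiv hp

theorem chartDiffEquiv_apply (he : e ∈ IsManifold.maximalAtlas 𝓘(ℝ, E) ∞ M) {p : M}
    (hp : p ∈ e.source) (v : TangentSpace 𝓘(ℝ, E) p) : chartDiffEquiv he hp v = chartDiff e p v :=
  rfl

/-- A 2-form is determined by its expression in a chart. -/
theorem formInChart_chartDiff (he : e ∈ IsManifold.maximalAtlas 𝓘(ℝ, E) ∞ M)
    (Ω : ∀ p : M, (TangentSpace 𝓘(ℝ, E) p) [⋀^Fin 2]→L[ℝ] ℝ) {p : M} (hp : p ∈ e.source)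
    (v w : TangentSpace 𝓘(ℝ, E) p) :
    formInChart Ω e (e p) ![chartDiff e p v, chartDiff e p w] = Ω p ![v, w] := by
  have h1 := (mdifferentiable_of_mem_maximalAtlas he).symm_comp_deriv hp
  -- The point `e.symm (e p)` equals `p` only propositionally; all tangent spaces being copies of
  -- `E`, the form can be compared over a variable point `q`.
  have h2 : ∀ q : M, q = p → ∀ u : Fin 2 → E,
      (Ω q : E [⋀^Fin 2]→L[ℝ] ℝ) u = (Ω p : E [⋀^Fin 2]→L[ℝ] ℝ) u := by
    rintro q rfl u
    rfl
  refine Eq.trans ?_ (h2 _ (e.left_inv hp) ![v, w])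
  change (Ω (e.symm (e p)) : E [⋀^Fin 2]→L[ℝ] ℝ) _ = (Ω (e.symm (e p)) : E [⋀^Fin 2]→L[ℝ] ℝ) _
  refine congrArg _ (funext fun i => ?_)
  fin_cases i
  · exact DFunLike.congr_fun h1 v
  · exact DFunLike.congr_fun h1 w

/-- A distribution which is constant in a chart is integrable on the domain of the chart. -/
theorem isIntegrable_of_chart (he : e ∈ IsManifold.maximalAtlas 𝓘(ℝ, E) ∞ M)
    {D : ∀ p : M, Submodule ℝ (TangentSpace 𝓘(ℝ, E) p)} (W : Submodule ℝ E)
    (hD : ∀ p ∈ e.source, ∀ v : TangentSpace 𝓘(ℝ, E) p,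
      v ∈ D p ↔ chartDiff e p v ∈ W) :
    IsIntegrable e.source D :=
  fun _ hp => ⟨e, he, hp, subset_rfl, W, fun q v hq => hD q hq v⟩

/-- A symplectic form in a chart. -/
theorem SymplecticForm.isSymplecticNear [FiniteDimensional ℝ E] (Ω : SymplecticForm E M)
    (he : e ∈ IsManifold.maximalAtlas 𝓘(ℝ, E) ∞ M) {y : E} (hy : y ∈ e.target) :
    IsSymplecticNear (fun z => alternatingToBilin (formInChart Ω.toFun e z)) y := by
  have hmd := mdifferentiable_of_mem_maximalAtlas he
  have hmem := e.open_target.mem_nhds hy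
  have hsm : ∀ z ∈ e.target, ContDiffAt ℝ ∞ (formInChart Ω.toFun e) z := fun z hz =>
    (Ω.smooth e he).contDiffAt (e.open_target.mem_nhds hz)
  refine ⟨?_, ?_, ?_, ?_⟩
  · filter_upwards [hmem] with z hz
    exact contDiff_alternatingToBilin.contDiffAt.comp z (hsm z hz)
  · filter_upwards with z v
    exact (formInChart Ω.toFun e z).map_eq_zero_of_eq ![v, v] (i := 0) (j := 1) rfl (by simp)
  · filter_upwards [hmem] with z hz
    exact alternatingToBilin_closed ((hsm z hz).differentiableAt (by simp)) (Ω.closed e he z hz)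
  · set b := alternatingToBilin (formInChart Ω.toFun e y)
    have hinj : Function.Injective b := by
      rw [injective_iff_map_eq_zero]
      intro v hv
      obtain ⟨p, hp, rfl⟩ : ∃ p ∈ e.source, e p = y := ⟨e.symm y, e.map_target hy, e.right_inv hy⟩
      obtain ⟨v', rfl⟩ := (chartDiffEquiv he hp).surjective v
      rw [EmbeddingLike.map_eq_zero_iff]
      refine Ω.nondegenerate p v' fun w => ?_
      rw [← formInChart_chartDiff he Ω.toFun hp]
      exact DFunLike.congr_fun hv (chartDiff e p w)
    have hdim : Module.finrank ℝ E = Module.finrank ℝ (E →L[ℝ] ℝ) := by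
      rw [← (LinearMap.toContinuousLinearMap (𝕜 := ℝ) (E := E) (F' := ℝ)).finrank_eq]
      exact (Subspace.dual_finrank_eq (K := ℝ) (V := E)).symm
    exact ⟨(LinearEquiv.ofInjectiveOfFinrankEq b.toLinearMap hinj hdim).toContinuousLinearEquiv,
      rfl⟩

variable [IsManifold 𝓘(ℝ, E) ∞ M]

/-- A distribution which is constant in a chart is smooth on the domain of the chart. -/
theorem isDistribution_of_chart [FiniteDimensional ℝ E]
    (he : e ∈ IsManifold.maximalAtlas 𝓘(ℝ, E) ∞ M)
    {D : ∀ p : M, Submodule ℝ (TangentSpace 𝓘(ℝ, E) p)} (W : Submodule ℝ E)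
    (hD : ∀ p ∈ e.source, ∀ v : TangentSpace 𝓘(ℝ, E) p,
      v ∈ D p ↔ chartDiff e p v ∈ W) :
    IsDistribution (Module.finrank ℝ W) e.source D := by
  have hmd := mdifferentiable_of_mem_maximalAtlas he
  intro p hp
  let β := Module.finBasis ℝ W
  refine ⟨e.source, e.open_source, hp, subset_rfl, fun i => VectorField.mpullback 𝓘(ℝ, E) 𝓘(ℝ, E) e
    (fun _ => (β i : E)), fun i q hq => ?_, fun q hq => ?_⟩
  · refine (ContMDiffAt.mpullback_vectorField_preimage (n := ∞) ?_
      (contMDiffAt_of_mem_maximalAtlas he hq) ⟨hmd.mfderiv hq, rfl⟩ (by simp)).contMDiffWithinAt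
    exact contMDiffAt_vectorSpace_iff_contDiffAt.2 contDiffAt_const
  · let L := chartDiffEquiv he hq
    have hX : ∀ i, VectorField.mpullback 𝓘(ℝ, E) 𝓘(ℝ, E) e (fun _ => (β i : E)) q =
        L.symm (β i) := fun i => by
      change (L : TangentSpace 𝓘(ℝ, E) q →L[ℝ] E).inverse (β i : E) = _
      rw [ContinuousLinearMap.inverse_equiv]
      rfl
    rw [funext hX]
    have hli : LinearIndependent ℝ (fun i => (β i : E)) :=
      β.linearIndependent.map' W.subtype W.ker_subtype
    refine ⟨hli.map' L.symm.toLinearEquiv.toLinearMap L.symm.toLinearEquiv.ker, ?_⟩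
    have hspan : Submodule.span ℝ (Set.range fun i => (β i : E)) = W := by
      have h1 : Set.range (fun i => (β i : E)) = W.subtype '' Set.range β := by
        rw [← Set.range_comp]
        rfl
      rw [h1, Submodule.span_image, β.span_eq, Submodule.map_top, Submodule.range_subtype]
    have h2 : Set.range (fun i => L.symm (β i : E)) =
        L.symm.toLinearEquiv.toLinearMap '' Set.range (fun i => (β i : E)) := by
      rw [← Set.range_comp]
      rfl
    rw [h2, Submodule.span_image, hspan]
    ext v
    rw [hD q hq, Submodule.mem_map]
    constructor
    · intro h
      exact ⟨_, h, L.symm_apply_apply v⟩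
    · rintro ⟨y, hy, rfl⟩
      have h3 : chartDiff e q (L.symm y) = y := L.apply_symm_apply y
      change chartDiff e q (L.symm y) ∈ W
      rwa [h3]

/-- Darboux's theorem on a symplectic manifold, with a Hamiltonian vector field made constant. -/
theorem SymplecticForm.exists_darboux_chart [FiniteDimensional ℝ E] (Ω : SymplecticForm E M)
    {H : M → ℝ} (hH : ContMDiff 𝓘(ℝ, E) 𝓘(ℝ, ℝ) ∞ H) {m : M}
    (hm : hamiltonianVectorField Ω H m ≠ 0) :
    ∃ e ∈ IsManifold.maximalAtlas 𝓘(ℝ, E) ∞ M, m ∈ e.source ∧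
      ∃ (B : E →L[ℝ] E →L[ℝ] ℝ) (c : E), ∀ p ∈ e.source,
        (∀ v w : TangentSpace 𝓘(ℝ, E) p, Ω.toFun p ![v, w] =
          B (chartDiff e p v) (chartDiff e p w)) ∧
        chartDiff e p (hamiltonianVectorField Ω H p) = c := by
  set e₀ := chartAt E m
  have he₀ : e₀ ∈ IsManifold.maximalAtlas 𝓘(ℝ, E) ∞ M := IsManifold.chart_mem_maximalAtlas m
  have hme₀ : m ∈ e₀.source := mem_chart_source E m
  have hmd₀ := mdifferentiable_of_mem_maximalAtlas he₀
  have hb := Ω.isSymplecticNear he₀ (e₀.map_source hme₀)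
  set b : E → E →L[ℝ] E →L[ℝ] ℝ := fun z => alternatingToBilin (formInChart Ω.toFun e₀ z)
  have hbΩ : ∀ p ∈ e₀.source, ∀ v w : TangentSpace 𝓘(ℝ, E) p, Ω.toFun p ![v, w] =
      b (e₀ p) (chartDiff e₀ p v) (chartDiff e₀ p w) := by
    exact fun p hp v w => (formInChart_chartDiff he₀ Ω.toFun hp v w).symm
  have hHc : ∀ z ∈ e₀.target, ContDiffAt ℝ ∞ (fun z => H (e₀.symm z)) z := fun z hz => by
    rw [← contMDiffAt_iff_contDiffAt]
    exact hH.contMDiffAt.comp z (contMDiffAt_symm_of_mem_maximalAtlas he₀ hz)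
  have hHd : ∀ p ∈ e₀.source, ∀ v : TangentSpace 𝓘(ℝ, E) p,
      fderiv ℝ (fun z => H (e₀.symm z)) (e₀ p) (chartDiff e₀ p v) =
        mfderiv 𝓘(ℝ, E) 𝓘(ℝ, ℝ) H p v := by
    intro p hp v
    have h1 : (fun q => H (e₀.symm (e₀ q))) =ᶠ[𝓝 p] H := by
      filter_upwards [e₀.open_source.mem_nhds hp] with q hq
      rw [e₀.left_inv hq]
    have h2 := mfderiv_comp p (g := fun z => H (e₀.symm z)) (f := e₀)
      ((hHc _ (e₀.map_source hp)).differentiableAt (by simp)).mdifferentiableAt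
      (hmd₀.mdifferentiableAt hp)
    rw [← h1.mfderiv_eq]
    rw [mfderiv_eq_fderiv] at h2
    exact (DFunLike.congr_fun h2 v).symm
  have hdH : fderiv ℝ (fun z => H (e₀.symm z)) (e₀ m) ≠ 0 := by
    intro h0
    refine hm (Ω.nondegenerate m _ fun w => ?_)
    rw [hamiltonianVectorField_spec, ← hHd m hme₀, h0]
    rfl
  have htgt := e₀.open_target.mem_nhds (e₀.map_source hme₀)
  obtain ⟨Φ, hmΦ, hΦsub, hΦsm, hΦsm', hform, c, hc⟩ := hb.exists_darboux_chart
    (H := fun z => H (e₀.symm z)) (Filter.mem_of_superset htgt hHc) hdH htgt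
  set e := e₀.trans Φ
  have hsrc : ∀ p, p ∈ e.source → p ∈ e₀.source ∧ e₀ p ∈ Φ.source := fun p hp => by
    rwa [OpenPartialHomeomorph.trans_source] at hp
  have he : e ∈ IsManifold.maximalAtlas 𝓘(ℝ, E) ∞ M := by
    refine e.mem_maximalAtlas_of_contMDiffOn (fun p hp => ?_) (fun y hy => ?_)
    · exact ((hΦsm _ (hsrc p hp).2).contMDiffAt.comp p
        (contMDiffAt_of_mem_maximalAtlas he₀ (hsrc p hp).1)).contMDiffWithinAt
    · rw [OpenPartialHomeomorph.trans_target] at hy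
      exact ((contMDiffAt_symm_of_mem_maximalAtlas he₀ hy.2).comp y
        (hΦsm' _ hy.1).contMDiffAt).contMDiffWithinAt
  have hed : ∀ p ∈ e.source, ∀ v : TangentSpace 𝓘(ℝ, E) p,
      chartDiff e p v =
        fderiv ℝ Φ (e₀ p) (chartDiff e₀ p v) := by
    intro p hp v
    have h2 := mfderiv_comp p (g := Φ) (f := e₀)
      ((hΦsm _ (hsrc p hp).2).differentiableAt (by simp)).mdifferentiableAt
      (hmd₀.mdifferentiableAt (hsrc p hp).1)
    rw [mfderiv_eq_fderiv] at h2
    exact DFunLike.congr_fun h2 v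
  have hΩ : ∀ p ∈ e.source, ∀ v w : TangentSpace 𝓘(ℝ, E) p, Ω.toFun p ![v, w] =
      b (e₀ m) (chartDiff e p v) (chartDiff e p w) := by
    intro p hp v w
    rw [hbΩ p (hsrc p hp).1, hform _ (hsrc p hp).2, hed p hp, hed p hp]
  refine ⟨e, he, ?_, b (e₀ m), c, fun p hp => ⟨hΩ p hp, ?_⟩⟩
  · rw [OpenPartialHomeomorph.trans_source]
    exact ⟨hme₀, hmΦ⟩
  -- The image of X_H and `c` pair identically with every vector, both representing dH, so
  -- nondegeneracy identifies them.
  · obtain ⟨L, hL⟩ := hb.isInvertible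
    have hinj : Function.Injective (b (e₀ m)) := hL ▸ L.injective
    apply hinj
    ext u
    obtain ⟨w, rfl⟩ := (chartDiffEquiv he hp).surjective u
    have h1 := hΩ p hp (hamiltonianVectorField Ω H p) w
    rw [hamiltonianVectorField_spec, ← hHd p (hsrc p hp).1, hc _ (hsrc p hp).2,
      ← hed p hp] at h1
    exact h1.symm

end Charts

/-! ### Openness of transversality to the fibres. -/

section Transversality

variable {E : Type*} [NormedAddCommGroup E] [NormedSpace ℝ E]
  {M : Type*} [TopologicalSpace M] [ChartedSpace E M]
  {E' : Type*} [NormedAddCommGroup E'] [NormedSpace ℝ E']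
  {e : OpenPartialHomeomorph M E}

/-- The distribution which in the chart `e` is constant with value `W`. -/
noncomputable def constantDistribution (e : OpenPartialHomeomorph M E) (W : Submodule ℝ E) (p : M) :
    Submodule ℝ (TangentSpace 𝓘(ℝ, E) p) :=
  W.comap (chartDiff e p).toLinearMap

theorem finrank_constantDistribution (he : e ∈ IsManifold.maximalAtlas 𝓘(ℝ, E) ∞ M) {p : M}
    (hp : p ∈ e.source) (W : Submodule ℝ E) :
    Module.finrank ℝ (constantDistribution e W p) = Module.finrank ℝ W := by
  have h := Submodule.map_equiv_eq_comap_symm (chartDiffEquiv he hp).symm.toLinearEquiv W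
  have h' : constantDistribution e W p =
      W.map (chartDiffEquiv he hp).symm.toLinearEquiv.toLinearMap := h.symm
  rw [h']
  exact LinearEquiv.finrank_map_eq (chartDiffEquiv he hp).symm.toLinearEquiv W

theorem mfderiv_clm_comp_chart (he : e ∈ IsManifold.maximalAtlas 𝓘(ℝ, E) ∞ M) {p : M}
    (hp : p ∈ e.source) (A : E →L[ℝ] E') (v : TangentSpace 𝓘(ℝ, E) p) :
    mfderiv 𝓘(ℝ, E) 𝓘(ℝ, E') (fun q => A (e q)) p v = A (chartDiff e p v) := by
  have h := mfderiv_comp p (g := A) (f := e) A.differentiableAt.mdifferentiableAt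
    ((mdifferentiable_of_mem_maximalAtlas he).mdifferentiableAt hp)
  rw [mfderiv_eq_fderiv, A.fderiv] at h
  exact DFunLike.congr_fun h v

variable {N : Type*} [TopologicalSpace N] [ChartedSpace E' N]

theorem finrank_kerDiff_add [FiniteDimensional ℝ E] {f : M → N} {U : Set M} (hf : IsSubmersionOn E E' U f) {p : M}
    (hp : p ∈ U) :
    Module.finrank ℝ (kerDiff E E' f p) + Module.finrank ℝ E' = Module.finrank ℝ E := by
  have : FiniteDimensional ℝ (TangentSpace 𝓘(ℝ, E) p) := inferInstanceAs (FiniteDimensional ℝ E)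
  have h := (mfderiv 𝓘(ℝ, E) 𝓘(ℝ, E') f p).toLinearMap.finrank_range_add_finrank_ker
  rw [LinearMap.range_eq_top.2 (hf.surjective_mfderiv p hp), finrank_top, add_comm] at h
  exact h

variable [FiniteDimensional ℝ E] [FiniteDimensional ℝ E'] [IsManifold 𝓘(ℝ, E') ∞ N]

/-- Transversality of a distribution which is constant in a chart to the fibres of a submersion is
an open condition. -/
theorem eventually_isCompl_kerDiff (he : e ∈ IsManifold.maximalAtlas 𝓘(ℝ, E) ∞ M) {m : M}
    (hm : m ∈ e.source) {f : M → N} (hf : IsSubmersionOn E E' Set.univ f) {W : Submodule ℝ E}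
    (hW : IsCompl (kerDiff E E' f m) (constantDistribution e W m)) :
    ∀ᶠ p in 𝓝 m, IsCompl (kerDiff E E' f p) (constantDistribution e W p) := by
  have hfd : ∀ p : M, FiniteDimensional ℝ (TangentSpace 𝓘(ℝ, E) p) := fun _ =>
    inferInstanceAs (FiniteDimensional ℝ E)
  have hdim : ∀ p ∈ e.source, Module.finrank ℝ (kerDiff E E' f p) +
      Module.finrank ℝ (constantDistribution e W p) = Module.finrank ℝ E := by
    intro p hp
    have h1 : Module.finrank ℝ (kerDiff E E' f m) + Module.finrank ℝ (constantDistribution e W m) =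
        Module.finrank ℝ E := Submodule.finrank_add_eq_of_isCompl hW
    have h2 := finrank_kerDiff_add hf (Set.mem_univ m)
    have h3 := finrank_kerDiff_add hf (Set.mem_univ p)
    rw [finrank_constantDistribution he hm] at h1
    rw [finrank_constantDistribution he hp]
    omega
  have hl : Module.finrank ℝ W + Module.finrank ℝ
      (Fin (Module.finrank ℝ E - Module.finrank ℝ W) → ℝ) = Module.finrank ℝ E := by
    rw [Module.finrank_fin_fun]
    have := W.finrank_le
    omega
  obtain ⟨A₀, -, hA₀⟩ := exists_surjective_ker_eq W hl
  let A := LinearMap.toContinuousLinearMap A₀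
  have hA : ∀ v, A v = 0 ↔ v ∈ W := fun v => by
    have h : v ∈ LinearMap.ker A₀ ↔ A₀ v = 0 := LinearMap.mem_ker
    rw [hA₀] at h
    exact h.symm
  set eN := chartAt E' (f m)
  have heN : eN ∈ IsManifold.maximalAtlas 𝓘(ℝ, E') ∞ N := IsManifold.chart_mem_maximalAtlas _
  have hmN : f m ∈ eN.source := mem_chart_source E' (f m)
  have hfs : ∀ p, ContMDiffAt 𝓘(ℝ, E) 𝓘(ℝ, E') ∞ f p := fun p =>
    hf.smooth.contMDiffAt Filter.univ_mem
  have hgood : ∀ᶠ p in 𝓝 m, p ∈ e.source ∧ f p ∈ eN.source :=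
    Filter.Eventually.and (e.open_source.mem_nhds hm)
      ((hfs m).continuousAt.eventually (eN.open_source.mem_nhds hmN))
  let g : E → E' := fun y => eN (f (e.symm y))
  have hg : ∀ p, p ∈ e.source ∧ f p ∈ eN.source → ContDiffAt ℝ ∞ g (e p) := fun p hp => by
    rw [← contMDiffAt_iff_contDiffAt]
    have h1 := contMDiffAt_symm_of_mem_maximalAtlas he (e.map_source hp.1)
    have h2 : ContMDiffAt 𝓘(ℝ, E') 𝓘(ℝ, E') ∞ eN (f (e.symm (e p))) := by
      rw [e.left_inv hp.1]
      exact contMDiffAt_of_mem_maximalAtlas heN hp.2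
    exact h2.comp (e p) ((hfs _).comp (e p) h1)
  have hgd : ∀ p, p ∈ e.source ∧ f p ∈ eN.source → ∀ v : TangentSpace 𝓘(ℝ, E) p,
      fderiv ℝ g (e p) (chartDiff e p v) = chartDiff eN (f p) (mfderiv 𝓘(ℝ, E) 𝓘(ℝ, E') f p v) := by
    intro p hp v
    have h1 : (g ∘ e) =ᶠ[𝓝 p] eN ∘ f := by
      filter_upwards [e.open_source.mem_nhds hp.1] with q hq
      change eN (f (e.symm (e q))) = eN (f q)
      rw [e.left_inv hq]
    have h2 := mfderiv_comp p (g := g) (f := e)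
      ((hg p hp).differentiableAt (by simp)).mdifferentiableAt
      ((mdifferentiable_of_mem_maximalAtlas he).mdifferentiableAt hp.1)
    have h3 := mfderiv_comp p (g := eN) (f := f)
      ((mdifferentiable_of_mem_maximalAtlas heN).mdifferentiableAt hp.2)
      ((hfs p).mdifferentiableAt (by simp))
    rw [mfderiv_eq_fderiv] at h2
    exact DFunLike.congr_fun (h2.symm.trans (h1.mfderiv_eq.trans h3)) v
  have hker : ∀ p (hp : p ∈ e.source ∧ f p ∈ eN.source), ∀ v : TangentSpace 𝓘(ℝ, E) p,
      v ∈ kerDiff E E' f p ↔ fderiv ℝ g (e p) (chartDiff e p v) = 0 := by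
    intro p hp v
    rw [hgd p hp, ← chartDiffEquiv_apply heN hp.2]
    exact (map_eq_zero_iff _ (chartDiffEquiv heN hp.2).injective).symm
  -- With `W` the kernel of `A`, transversality means that `(dg, A)` is injective, hence invertible
  -- by dimension; invertibility is open.
  have hinj : Function.Injective ((fderiv ℝ g (e m)).prod A) := by
    rw [injective_iff_map_eq_zero]
    intro y hy
    obtain ⟨v, rfl⟩ := (chartDiffEquiv he hm).surjective y
    obtain ⟨h1, h2⟩ := Prod.ext_iff.1 hy
    have h3 : v ∈ kerDiff E E' f m := (hker m ⟨hm, hmN⟩ v).2 h1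
    have h4 : v ∈ constantDistribution e W m := (hA _).1 h2
    rw [Submodule.disjoint_def.1 hW.disjoint v h3 h4, map_zero]
  have hdim' : Module.finrank ℝ E = Module.finrank ℝ
      (E' × (Fin (Module.finrank ℝ E - Module.finrank ℝ W) → ℝ)) := by
    have h1 := hdim m hm
    have h2 := finrank_kerDiff_add hf (Set.mem_univ m)
    rw [finrank_constantDistribution he hm] at h1
    rw [Module.finrank_prod, Module.finrank_fin_fun]
    omega
  let L := (LinearEquiv.ofInjectiveOfFinrankEq ((fderiv ℝ g (e m)).prod A).toLinearMap hinj
    hdim').toContinuousLinearEquiv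
  have hcont : Filter.Tendsto (fun p => (fderiv ℝ g (e p)).prod A) (𝓝 m)
      (𝓝 (L : E →L[ℝ] E' × (Fin (Module.finrank ℝ E - Module.finrank ℝ W) → ℝ))) := by
    have h1 : ContinuousAt (fderiv ℝ g) (e m) :=
      ((hg m ⟨hm, hmN⟩).fderiv_right (m := ∞) (by simp)).continuousAt
    have h2 : ContinuousAt (fun p => fderiv ℝ g (e p)) m := h1.comp (e.continuousAt hm)
    have h3 : ∀ T : E →L[ℝ] E', T.prod A = (ContinuousLinearMap.inl ℝ E' _).comp T +
        (ContinuousLinearMap.inr ℝ E' _).comp A := fun T => by ext v <;> simp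
    change ContinuousAt (fun p => (fderiv ℝ g (e p)).prod A) m
    simp only [h3]
    exact (continuousAt_const.clm_comp h2).add continuousAt_const
  filter_upwards [hgood, hcont.eventually L.nhds] with p hp hL
  obtain ⟨L', hL'⟩ := hL
  have hdisj : Disjoint (kerDiff E E' f p) (constantDistribution e W p) := by
    rw [Submodule.disjoint_def]
    intro v hv hv'
    have h1 : ((fderiv ℝ g (e p)).prod A) (chartDiff e p v) = 0 :=
      Prod.ext ((hker p hp v).1 hv) ((hA _).2 hv')
    rw [← hL'] at h1
    exact (map_eq_zero_iff _ (chartDiffEquiv he hp.1).injective).1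
      ((map_eq_zero_iff _ L'.injective).1 h1)
  exact ⟨hdisj, codisjoint_iff.2 (Submodule.eq_top_of_disjoint _ _ (hdim p hp.1).ge hdisj)⟩

end Transversality

/-! ### Darboux charts with a transverse isotropic subspace. -/

section AdaptedCharts

variable {E : Type*} [NormedAddCommGroup E] [NormedSpace ℝ E]
  {M : Type*} [TopologicalSpace M] [ChartedSpace E M]
  {e : OpenPartialHomeomorph M E}

/-- In a chart in which a symplectic form is constant, so is the symplectic orthogonal of a constant
distribution. -/
theorem mem_symplecticOrthogonal_constantDistribution
    (he : e ∈ IsManifold.maximalAtlas 𝓘(ℝ, E) ∞ M) {Ω : SymplecticForm E M}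
    {B : LinearMap.BilinForm ℝ E} (hB : B.IsAlt) {p : M} (hp : p ∈ e.source)
    (hΩ : ∀ v w : TangentSpace 𝓘(ℝ, E) p,
      Ω.toFun p ![v, w] = B (chartDiff e p v) (chartDiff e p w))
    (W : Submodule ℝ E) (v : TangentSpace 𝓘(ℝ, E) p) :
    v ∈ symplecticOrthogonal Ω p (constantDistribution e W p) ↔
      chartDiff e p v ∈ B.orthogonal W := by
  constructor
  · intro h y hy
    obtain ⟨w, rfl⟩ := (chartDiffEquiv he hp).surjective y
    exact hB.isRefl _ _ ((hΩ v w).symm.trans (h w hy))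
  · intro h w hw
    exact (hΩ v w).trans (hB.isRefl _ _ (h _ hw))

variable [IsManifold 𝓘(ℝ, E) ∞ M] [FiniteDimensional ℝ E]
  {E' : Type*} [NormedAddCommGroup E'] [NormedSpace ℝ E'] [FiniteDimensional ℝ E']
  {N : Type*} [TopologicalSpace N] [ChartedSpace E' N] [IsManifold 𝓘(ℝ, E') ∞ N]

/-- A Darboux chart with an isotropic subspace of the model space that contains the (constant)
Hamiltonian vector field and is transverse to the fibres of a submersion. -/
theorem SymplecticForm.exists_adapted_chart (Ω : SymplecticForm E M) {H : M → ℝ}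
    (hH : ContMDiff 𝓘(ℝ, E) 𝓘(ℝ, ℝ) ∞ H) {f : M → N} (hf : IsSubmersionOn E E' Set.univ f) {m : M}
    (hX : hamiltonianVectorField Ω H m ∉ kerDiff E E' f m)
    (hco : symplecticOrthogonal Ω m (kerDiff E E' f m) ≤ kerDiff E E' f m) :
    ∃ e ∈ IsManifold.maximalAtlas 𝓘(ℝ, E) ∞ M, m ∈ e.source ∧
      ∃ B : LinearMap.BilinForm ℝ E, B.IsAlt ∧ B.Nondegenerate ∧
        (∀ p ∈ e.source, ∀ v w : TangentSpace 𝓘(ℝ, E) p,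
          Ω.toFun p ![v, w] = B (chartDiff e p v) (chartDiff e p w)) ∧
        ∃ W : Submodule ℝ E, W ≤ B.orthogonal W ∧ ∀ p ∈ e.source,
          hamiltonianVectorField Ω H p ∈ constantDistribution e W p ∧
          IsCompl (kerDiff E E' f p) (constantDistribution e W p) := by
  have hX0 : hamiltonianVectorField Ω H m ≠ 0 := fun h => hX (h ▸ Submodule.zero_mem _)
  obtain ⟨e, he, hme, B₀, c, h⟩ := Ω.exists_darboux_chart hH hX0
  let B : LinearMap.BilinForm ℝ E := B₀.toBilinForm
  have hΩ : ∀ p ∈ e.source, ∀ v w : TangentSpace 𝓘(ℝ, E) p,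
      Ω.toFun p ![v, w] = B (chartDiff e p v) (chartDiff e p w) := fun p hp => (h p hp).1
  let L := chartDiffEquiv he hme
  have hB : B.IsAlt := fun y => by
    obtain ⟨v, rfl⟩ := L.surjective y
    exact (hΩ m hme v v).symm.trans
      ((Ω.toFun m).map_eq_zero_of_eq ![v, v] (i := 0) (j := 1) rfl (by simp))
  have hnd : B.Nondegenerate := by
    refine hB.isRefl.nondegenerate_iff_separatingLeft.2 fun y hy => ?_
    obtain ⟨v, rfl⟩ := L.surjective y
    rw [Ω.nondegenerate m v fun w => (hΩ m hme v w).trans (hy _), map_zero]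
  -- Only the kernel at `m` is transferred to the model space: it need not be constant in the chart,
  -- and the other points are handled by openness.
  let K : Submodule ℝ E := (kerDiff E E' f m).comap L.symm.toLinearEquiv.toLinearMap
  have hK : ∀ v : TangentSpace 𝓘(ℝ, E) m, chartDiff e m v ∈ K ↔ v ∈ kerDiff E E' f m := fun v => by
    change L.symm (L v) ∈ kerDiff E E' f m ↔ _
    rw [L.symm_apply_apply]
  have hKco : B.orthogonal K ≤ K := by
    intro y hy
    obtain ⟨v, rfl⟩ := L.surjective y
    refine (hK v).2 (hco fun w hw => ?_)
    exact (hΩ m hme v w).trans (hB.isRefl _ _ (hy _ ((hK w).2 hw)))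
  have hcK : c ∉ K := by
    rw [← (h m hme).2]
    exact fun h' => hX ((hK _).1 h')
  obtain ⟨W, hcW, hKW, hW⟩ := exists_isotropic_isCompl B hB hnd hKco hcK
  have hWm : IsCompl (kerDiff E E' f m) (constantDistribution e W m) := by
    constructor
    · rw [Submodule.disjoint_def]
      intro v hv hv'
      have h0 : L v = 0 := Submodule.disjoint_def.1 hKW.disjoint _ ((hK v).2 hv) hv'
      exact (map_eq_zero_iff _ L.injective).1 h0
    · rw [codisjoint_iff, eq_top_iff]
      intro v _
      obtain ⟨y, hy, z, hz, hyz⟩ := Submodule.mem_sup.1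
        (hKW.codisjoint.eq_top ▸ Submodule.mem_top : L v ∈ K ⊔ W)
      refine Submodule.mem_sup.2 ⟨L.symm y, hy, L.symm z, ?_, ?_⟩
      · change L (L.symm z) ∈ W
        rwa [L.apply_symm_apply]
      · rw [← map_add, hyz, L.symm_apply_apply]
  obtain ⟨O, hO, hOo, hmO⟩ := eventually_nhds_iff.1 (eventually_isCompl_kerDiff he hme hf hWm)
  have hsrc : ∀ p ∈ (e.restr O).source, p ∈ e.source ∧ p ∈ O := fun p hp => by
    rwa [e.restr_source' O hOo] at hp
  refine ⟨e.restr O, restr_mem_maximalAtlas _ he hOo, ?_, B, hB, hnd,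
    fun p hp => hΩ p (hsrc p hp).1, W, hW, fun p hp => ⟨?_, hO p (hsrc p hp).2⟩⟩
  · rw [e.restr_source' O hOo]
    exact ⟨hme, hmO⟩
  · change chartDiff e p _ ∈ W
    rwa [(h p (hsrc p hp).1).2]

end AdaptedCharts

end HamiltonJacobi

/-! ### The distribution, its orthogonal and the submersion. -/

theorem proposition1 {s k : ℕ} (hk : 1 ≤ k)
    {M : Type*} [TopologicalSpace M] [T2Space M] [SecondCountableTopology M]
    [ChartedSpace 𝔼[2 * s] M] [IsManifold (𝓡 (2 * s)) ∞ M]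
    {N : Type*} [TopologicalSpace N] [T2Space N] [SecondCountableTopology N]
    [ChartedSpace 𝔼[k] N] [IsManifold (𝓡 k) ∞ N]
    (Ω : SymplecticForm 𝔼[2 * s] M)
    (H : M → ℝ) (hH : ContMDiff (𝓡 (2 * s)) 𝓘(ℝ, ℝ) ∞ H)
    (Pr : M → N)
    (hPr : IsFibration 𝔼[2 * s] 𝔼[k] Pr)
    (m : M)
    (hX : hamiltonianVectorField Ω H m ∉ kerDiff 𝔼[2 * s] 𝔼[k] Pr m)
    (hco : symplecticOrthogonal Ω m (kerDiff 𝔼[2 * s] 𝔼[k] Pr m) ≤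
      kerDiff 𝔼[2 * s] 𝔼[k] Pr m) :
    ∃ U : Set M, IsOpen U ∧ m ∈ U ∧
      ∃ D : ∀ p : M, Submodule ℝ (TangentSpace (𝓡 (2 * s)) p),
        IsDistribution k U D ∧
        (∀ p ∈ U, hamiltonianVectorField Ω H p ∈ D p) ∧
        (∀ p ∈ U, IsCompl (kerDiff 𝔼[2 * s] 𝔼[k] Pr p) (D p)) ∧
        (∀ p ∈ U, D p ≤ symplecticOrthogonal Ω p (D p)) ∧
        IsIntegrable U D ∧
        IsDistribution (2 * s - k) U (fun p => symplecticOrthogonal Ω p (D p)) ∧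
        IsIntegrable U (fun p => symplecticOrthogonal Ω p (D p)) ∧
        ∃ F : M → 𝔼[2 * s - k],
          (∀ p ∈ U, D p = kerDiff 𝔼[2 * s] 𝔼[2 * s - k] F p) ∧
          (∀ p ∈ U, IsCompl (kerDiff 𝔼[2 * s] 𝔼[k] Pr p)
            (kerDiff 𝔼[2 * s] 𝔼[2 * s - k] F p)) ∧
          IsFirstIntegralsSubmersion 𝔼[2 * s] 𝔼[2 * s - k] Ω H U F ∧
          IsSymplecticallyComplete 𝔼[2 * s] 𝔼[2 * s - k] Ω U F := by
  obtain ⟨e, he, hme, B, hB, hnd, hΩ, W, hW, hWp⟩ :=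
    Ω.exists_adapted_chart hH hPr.submersion hX hco
  have hfd : ∀ p : M, FiniteDimensional ℝ (TangentSpace (𝓡 (2 * s)) p) := fun _ =>
    inferInstanceAs (FiniteDimensional ℝ 𝔼[2 * s])
  have hker := finrank_kerDiff_add hPr.submersion (Set.mem_univ m)
  have hcompl : Module.finrank ℝ (kerDiff 𝔼[2 * s] 𝔼[k] Pr m) +
      Module.finrank ℝ (constantDistribution e W m) = Module.finrank ℝ 𝔼[2 * s] :=
    Submodule.finrank_add_eq_of_isCompl (hWp m hme).2
  rw [finrank_constantDistribution he hme] at hcompl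
  rw [finrank_euclideanSpace_fin, finrank_euclideanSpace_fin] at hker
  rw [finrank_euclideanSpace_fin] at hcompl
  have hWk : Module.finrank ℝ W = k := by omega
  have hWo : Module.finrank ℝ (B.orthogonal W) = 2 * s - k := by
    rw [LinearMap.BilinForm.finrank_orthogonal hnd, hWk, finrank_euclideanSpace_fin]
  -- `hker` forces `k ≤ 2 * s`, so the subtraction is not truncated.
  have hl : Module.finrank ℝ W + Module.finrank ℝ 𝔼[2 * s - k] = Module.finrank ℝ 𝔼[2 * s] := by
    rw [hWk, finrank_euclideanSpace_fin, finrank_euclideanSpace_fin]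
    omega
  obtain ⟨A₀, hAs, hAW⟩ := exists_surjective_ker_eq W hl
  let A := LinearMap.toContinuousLinearMap A₀
  have hD : ∀ p ∈ e.source, ∀ v : TangentSpace (𝓡 (2 * s)) p,
      v ∈ constantDistribution e W p ↔ chartDiff e p v ∈ W := fun _ _ _ => Iff.rfl
  have hDo : ∀ p ∈ e.source, ∀ v : TangentSpace (𝓡 (2 * s)) p,
      v ∈ symplecticOrthogonal Ω p (constantDistribution e W p) ↔
        chartDiff e p v ∈ B.orthogonal W := fun p hp v =>
    mem_symplecticOrthogonal_constantDistribution he hB hp (hΩ p hp) W v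
  let F : M → 𝔼[2 * s - k] := fun p => A (e p)
  have hFker : ∀ p ∈ e.source,
      constantDistribution e W p = kerDiff 𝔼[2 * s] 𝔼[2 * s - k] F p := by
    intro p hp
    ext v
    have h1 : chartDiff e p v ∈ LinearMap.ker A₀ ↔ A₀ (chartDiff e p v) = 0 := LinearMap.mem_ker
    rw [hAW] at h1
    refine h1.trans ?_
    change A (chartDiff e p v) = 0 ↔ mfderiv (𝓡 (2 * s)) (𝓡 (2 * s - k)) F p v = 0
    rw [← mfderiv_clm_comp_chart he hp A v]
    rfl
  have hFsub : IsSubmersionOn 𝔼[2 * s] 𝔼[2 * s - k] e.source F := by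
    refine ⟨A.contDiff.contMDiff.comp_contMDiffOn (contMDiffOn_of_mem_maximalAtlas he), ?_⟩
    intro p hp y
    obtain ⟨x, hx⟩ := hAs y
    obtain ⟨v, rfl⟩ := (chartDiffEquiv he hp).surjective x
    exact ⟨v, (mfderiv_clm_comp_chart he hp A v).trans hx⟩
  have hiso : ∀ p ∈ e.source, constantDistribution e W p ≤
      symplecticOrthogonal Ω p (constantDistribution e W p) := fun p hp v hv =>
    (hDo p hp v).2 (hW hv)
  refine ⟨e.source, e.open_source, hme, constantDistribution e W,
    hWk ▸ isDistribution_of_chart he W hD, fun p hp => (hWp p hp).1, fun p hp => (hWp p hp).2,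
    hiso, isIntegrable_of_chart he W hD, hWo ▸ isDistribution_of_chart he _ hDo,
    isIntegrable_of_chart he _ hDo, F, hFker, fun p hp => hFker p hp ▸ (hWp p hp).2,
    ⟨hFsub, fun p hp => hFker p hp ▸ (hWp p hp).1⟩,
    hFsub, fun p hp => hFker p hp ▸ hiso p hp, isIntegrable_of_chart he (B.orthogonal W) fun p hp v => ?_⟩
  rw [← hFker p hp]
  exact hDo p hp v
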